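/- Let $\Sigma$ be a $2$-polygraph, that is, a set $\Sigma_0$ of $0$-cells, a set $\Sigma_1$ of generating $1$-cells with source and target in $\Sigma_0$, and a set $\Sigma_2$ of generating $2$-cells $\alpha : s(\alpha)\Rightarrow t(\alpha)$ between parallel $1$-cells of the free category $\Sigma_1^*$. Let $\overline{\Sigma}=\Sigma_1^*/\Sigma_2$ be the category presented by $\Sigma$, write $\overline{u}$ for the image in $\overline\Sigma$ of a $1$-cell $u$ of $\Sigma_1^*$, and let $\Sigma^{\top}$ be the free $(2,1)$-category generated by $\Sigma$, that is, the free strict $2$-category on $\Sigma$ with all $2$-cells made invertible (vertical composition $\star_1$, horizontal composition $\star_0$). A natural system on $\overline\Sigma$ is a functor to abelian groups from the category of factorisations of $\overline\Sigma$, whose objects are the arrows $w$ of $\overline\Sigma$ and whose morphisms $w\to w'$ are the pairs $(u,v)$ of arrows with $uwv=w'$; the image of $a$ under $(u,v)$ is written $uav$. For $k=1,2$, let $\overline\Sigma[\Sigma_k]$ be the free natural system on generators $[\alpha]$ at $\overline\alpha$, one for each $\alpha\in\Sigma_k$, where $\overline\alpha$ is the common image of source and target if $k=2$. For a $1$-cell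 $u$ of $\Sigma_1^*$, define $[u]\in\overline\Sigma[\Sigma_1]_{\overline u}$ by extending $x\mapsto[x]$ through $[1]=0$ and $[uv]=[u]\overline v+\overline u[v]$. For a $2$-cell $f:u\Rightarrow v$ of $\Sigma^\top$, with $\overline f:=\overline u=\overline v$, define $[f]\in\overline\Sigma[\Sigma_2]_{\overline f}$ by extending $\alpha\mapsto[\alpha]$ through $[1_u]=0$, $[f^-]=-[f]$, $[f\star_1 g]=[f]+[g]$ and $[f\star_0 g]=[f]\overline g+\overline f[g]$. Let $\delta_2:\overline\Sigma[\Sigma_2]\to\overline\Sigma[\Sigma_1]$ be the morphism of natural systems with $\delta_2[\alpha]=[s(\alpha)]-[t(\alpha)]$, and let $h_2(\Sigma)=\ker\delta_2$ be the natural system of homological $2$-syzygies. The natural system $\Pi(\Sigma)$ of identities among relations is defined as follows: for an arrow $w$ of $\overline\Sigma$, the abelian group $\Pi(\Sigma)_w$ is generated by one element $\langle f\rangle$ for each closed $2$-cell $f:v\Rightarrow v$ of $\Sigma^\top$ with $\overline v=w$, subject to the relations $\langle f\star_1 g\rangle=\langle f\rangle+\langle g\rangle$ for $f,g:v\Rightarrow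 v$, and $\langle f\star_1 g\rangle=\langle g\star_1 f\rangle$ for $f:v\Rightarrow v'$ and $g:v'\Rightarrow v$; a morphism $(\overline p,\overline q)$ of the category of factorisations acts by $\langle f\rangle\mapsto\langle p f q\rangle$, which does not depend on the choice of the representatives $p$, $q$. \textbf{Theorem.} For every $2$-polygraph $\Sigma$, there is an isomorphism $\Pi(\Sigma)\simeq h_2(\Sigma)$ of natural systems on $\overline\Sigma$ that sends $\langle f\rangle$ to $[f]$ for every closed $2$-cell $f$ of $\Sigma^\top$. -/

import Mathlib

open CategoryTheory Quiver

universe v u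

section NaturalSystems

/-- Objects of the category of factorisations `F C` of a category `C`: the arrows of `C`. -/
structure FactCat (C : Type u) [Category.{v} C] where
  src : C
  tgt : C
  arrow : src ⟶ tgt

namespace FactCat

variable {C : Type u} [Category.{v} C]

/-- Morphisms `w ⟶ w'` of `F C`: pairs `(l, r)` of arrows of `C` with `l w r = w'`. -/
@[ext]
structure Hom (w w' : FactCat C) where
  l : w'.src ⟶ w.src
  r : w.tgt ⟶ w'.tgt
  fac : l ≫ w.arrow ≫ r = w'.arrow

instance : Category (FactCat C) where
  Hom := Hom
  id w := ⟨𝟙 _, 𝟙 _, by simp⟩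
  comp {w w' w''} k k' := ⟨k'.l ≫ k.l, k.r ≫ k'.r, by
    rw [← k'.fac, ← k.fac]; simp only [Category.assoc]⟩
  id_comp _ := by ext <;> simp
  comp_id _ := by ext <;> simp
  assoc _ _ _ := by ext <;> simp

@[simp] theorem id_l (w : FactCat C) : Hom.l (𝟙 w) = 𝟙 w.src := rfl
@[simp] theorem id_r (w : FactCat C) : Hom.r (𝟙 w) = 𝟙 w.tgt := rfl
@[simp] theorem comp_l {w w' w'' : FactCat C} (k : w ⟶ w') (k' : w' ⟶ w'') :
    Hom.l (k ≫ k') = Hom.l k' ≫ Hom.l k := rfl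
@[simp] theorem comp_r {w w' w'' : FactCat C} (k : w ⟶ w') (k' : w' ⟶ w'') :
    Hom.r (k ≫ k') = Hom.r k ≫ Hom.r k' := rfl

theorem hom_ext {w w' : FactCat C} {k k' : w ⟶ w'} (hl : Hom.l k = Hom.l k')
    (hr : Hom.r k = Hom.r k') : k = k' := Hom.ext hl hr

end FactCat

/-- Natural systems of abelian groups on `C`. -/
abbrev NatSys (C : Type u) [Category.{v} C] := FactCat C ⥤ AddCommGrpCat.{v}

variable {C : Type u} [Category.{u} C]

/-- The free natural system generated by a family `X` of arrows of `C`: its value at `w` is the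
free abelian group on the pairs `(i, k)` with `k : X i ⟶ w` in `F C`, that is, on the triples
`l [i] r` with `l (X i) r = w`. -/
def freeNat {ι : Type u} (X : ι → FactCat C) : NatSys C where
  obj w := AddCommGrpCat.of (FreeAbelianGroup (Σ i, (X i ⟶ w)))
  map k := AddCommGrpCat.ofHom (FreeAbelianGroup.map fun a => ⟨a.1, a.2 ≫ k⟩)
  map_id w := by
    ext x
    simp
  map_comp k k' := by
    ext x
    simp

/-- The generator `[i]` of the free natural system. -/
def freeNat.gen {ι : Type u} (X : ι → FactCat C) (i : ι) : (freeNat X).obj (X i) :=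
  FreeAbelianGroup.of (⟨i, 𝟙 (X i)⟩ : Σ j, (X j ⟶ X i))

/-- The morphism of natural systems out of a free natural system given by the images `d i` of the
generators `[i]`. -/
def freeNat.desc {ι : Type u} (X : ι → FactCat C) (D : NatSys C)
    (d : ∀ i, D.obj (X i)) : freeNat X ⟶ D where
  app w := AddCommGrpCat.ofHom (FreeAbelianGroup.lift fun a : Σ i, (X i ⟶ w) => D.map a.2 (d a.1))
  naturality w w' k := by
    apply AddCommGrpCat.hom_ext
    apply FreeAbelianGroup.lift_ext
    intro a
    change FreeAbelianGroup.lift (fun b : Σ i, (X i ⟶ w') => D.map b.2 (d b.1))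
        (FreeAbelianGroup.map (fun b : Σ i, (X i ⟶ w) => (⟨b.1, b.2 ≫ k⟩ : Σ i, (X i ⟶ w')))
          (FreeAbelianGroup.of a)) =
      D.map k (FreeAbelianGroup.lift (fun b : Σ i, (X i ⟶ w) => D.map b.2 (d b.1))
        (FreeAbelianGroup.of a))
    simp

end NaturalSystems

/-- A 2-polygraph: a set of 0-cells, a set of generating 1-cells `x ⟶ y` for all 0-cells `x`, `y`,
and a set of generating 2-cells `p ⇒ q` for all parallel 1-cells `p`, `q` of the free category,
whose arrows are the paths of generating 1-cells. -/
structure TwoPolygraph where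
  Obj : Type u
  [quiver : Quiver.{u} Obj]
  Gen : ∀ {x y : Obj}, Path x y → Path x y → Type u

namespace TwoPolygraph

attribute [instance] TwoPolygraph.quiver

variable (S : TwoPolygraph.{u})

/-- The 1-cells of the free category: paths of generating 1-cells. -/
abbrev Word (x y : S.Obj) : Type u := Path x y

section Presented

/-- Two 1-cells of the free category are related when they are source and target of a generating
2-cell. -/
def homRel : HomRel (Paths S.Obj) := fun x y p q => Nonempty (S.Gen (x := x) (y := y) p q)

/-- The category presented by `S`: the quotient of the free category on the generating 1-cells by
the congruence generated by the generating 2-cells. -/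
abbrev Pres : Type u := CategoryTheory.Quotient S.homRel

variable {S}

/-- The 0-cell `x`, seen in the presented category. -/
abbrev pt (x : S.Obj) : S.Pres := ⟨x⟩

/-- The 0-cell underlying an object of the presented category. -/
abbrev ob (a : S.Pres) : S.Obj := a.as

/-- The image of a 1-cell under the canonical projection onto the presented category. -/
def proj {x y : S.Obj} (p : S.Word x y) : pt x ⟶ pt y :=
  (CategoryTheory.Quotient.functor S.homRel).map (X := x) (Y := y) p

/-- The image of a 1-cell in the presented category, as an object of the category of
factorisations. -/
abbrev bar {x y : S.Obj} (p : S.Word x y) : FactCat S.Pres := ⟨pt x, pt y, proj p⟩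

theorem proj_nil (x : S.Obj) : proj (Path.nil : S.Word x x) = 𝟙 (pt x) :=
  (CategoryTheory.Quotient.functor S.homRel).map_id x

theorem proj_comp {x y z : S.Obj} (p : S.Word x y) (q : S.Word y z) :
    proj (p.comp q) = proj p ≫ proj q :=
  (CategoryTheory.Quotient.functor S.homRel).map_comp (X := x) (Y := y) (Z := z) p q

theorem proj_gen {x y : S.Obj} {p q : S.Word x y} (a : S.Gen p q) : proj p = proj q :=
  CategoryTheory.Quotient.sound (C := Paths S.Obj) (a := x) (b := y) S.homRel ⟨a⟩

theorem proj_surjective {a b : S.Pres} (u : a ⟶ b) : ∃ p : S.Word (ob a) (ob b), proj p = u :=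
  Quot.exists_rep u

/-- A chosen representative 1-cell of an arrow of the presented category. -/
noncomputable def rep {a b : S.Pres} (u : a ⟶ b) : S.Word (ob a) (ob b) := (proj_surjective u).choose

theorem proj_rep {a b : S.Pres} (u : a ⟶ b) : proj (rep u) = u := (proj_surjective u).choose_spec

end Presented

section TwoCells

variable {S}

/-- Formal composites of generating 2-cells and formal inverses. `vcomp` is the composition `⋆₁`
along 1-cells and `hcomp` the composition `⋆₀` along 0-cells. -/
inductive Term : ∀ {x y : S.Obj}, S.Word x y → S.Word x y → Type u
  | gen {x y : S.Obj} {p q : S.Word x y} (a : S.Gen p q) : Term p q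
  | id {x y : S.Obj} (p : S.Word x y) : Term p p
  | inv {x y : S.Obj} {p q : S.Word x y} (f : Term p q) : Term q p
  | vcomp {x y : S.Obj} {p q r : S.Word x y} (f : Term p q) (g : Term q r) : Term p r
  | hcomp {x y z : S.Obj} {p q : S.Word x y} {p' q' : S.Word y z} (f : Term p q) (g : Term p' q') :
      Term (p.comp p') (q.comp q')

/-- The congruence on formal composites generated by the axioms of (2,1)-categories. It relates
composites whose boundaries are a priori different paths, because the two sides of an axiom have
boundaries that are equal (such as `(p p') p''` and `p (p' p'')`) but not definitionally so. -/
inductive Term.Rel : ∀ {x y : S.Obj} {p q p' q' : S.Word x y}, Term p q → Term p' q' → Prop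
  | refl {x y : S.Obj} {p q : S.Word x y} (f : Term p q) : Rel f f
  | symm {x y : S.Obj} {p q p' q' : S.Word x y} {f : Term p q} {g : Term p' q'} :
      Rel f g → Rel g f
  | trans {x y : S.Obj} {p q p' q' p'' q'' : S.Word x y} {f : Term p q} {g : Term p' q'}
      {h : Term p'' q''} : Rel f g → Rel g h → Rel f h
  | inv_congr {x y : S.Obj} {p q p' q' : S.Word x y} {f : Term p q} {f' : Term p' q'} :
      Rel f f' → Rel (Term.inv f) (Term.inv f')
  | vcomp_congr {x y : S.Obj} {p q r p' q' r' : S.Word x y} {f : Term p q} {g : Term q r}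
      {f' : Term p' q'} {g' : Term q' r'} :
      Rel f f' → Rel g g' → Rel (Term.vcomp f g) (Term.vcomp f' g')
  | hcomp_congr {x y z : S.Obj} {p q p' q' : S.Word x y} {r s r' s' : S.Word y z} {f : Term p q}
      {g : Term r s} {f' : Term p' q'} {g' : Term r' s'} :
      Rel f f' → Rel g g' → Rel (Term.hcomp f g) (Term.hcomp f' g')
  | vcomp_assoc {x y : S.Obj} {p q r s : S.Word x y} (f : Term p q) (g : Term q r) (h : Term r s) :
      Rel (Term.vcomp (Term.vcomp f g) h) (Term.vcomp f (Term.vcomp g h))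
  | id_vcomp {x y : S.Obj} {p q : S.Word x y} (f : Term p q) : Rel (Term.vcomp (Term.id p) f) f
  | vcomp_id {x y : S.Obj} {p q : S.Word x y} (f : Term p q) : Rel (Term.vcomp f (Term.id q)) f
  | vcomp_inv {x y : S.Obj} {p q : S.Word x y} (f : Term p q) :
      Rel (Term.vcomp f (Term.inv f)) (Term.id p)
  | inv_vcomp {x y : S.Obj} {p q : S.Word x y} (f : Term p q) :
      Rel (Term.vcomp (Term.inv f) f) (Term.id q)
  | hcomp_assoc {x y z t : S.Obj} {p q : S.Word x y} {p' q' : S.Word y z} {p'' q'' : S.Word z t}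
      (f : Term p q) (g : Term p' q') (h : Term p'' q'') :
      Rel (Term.hcomp (Term.hcomp f g) h) (Term.hcomp f (Term.hcomp g h))
  | id_hcomp {x y : S.Obj} {p q : S.Word x y} (f : Term p q) :
      Rel (Term.hcomp (Term.id (Path.nil : S.Word x x)) f) f
  | hcomp_id {x y : S.Obj} {p q : S.Word x y} (f : Term p q) :
      Rel (Term.hcomp f (Term.id (Path.nil : S.Word y y))) f
  | id_hcomp_id {x y z : S.Obj} (p : S.Word x y) (q : S.Word y z) :
      Rel (Term.hcomp (Term.id p) (Term.id q)) (Term.id (p.comp q))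
  | exchange {x y z : S.Obj} {p q r : S.Word x y} {p' q' r' : S.Word y z} (f : Term p q)
      (g : Term q r) (h : Term p' q') (k : Term q' r') :
      Rel (Term.hcomp (Term.vcomp f g) (Term.vcomp h k))
        (Term.vcomp (Term.hcomp f h) (Term.hcomp g k))

instance Term.setoid {x y : S.Obj} (p q : S.Word x y) : Setoid (Term p q) where
  r f g := Term.Rel f g
  iseqv := ⟨Term.Rel.refl, Term.Rel.symm, Term.Rel.trans⟩

/-- The 2-cells `p ⇒ q` of the free (2,1)-category generated by `S`. -/
def Cell {x y : S.Obj} (p q : S.Word x y) : Type u := Quotient (Term.setoid p q)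

namespace Cell

/-- The generating 2-cells. -/
def gen {x y : S.Obj} {p q : S.Word x y} (a : S.Gen p q) : Cell p q :=
  Quotient.mk _ (Term.gen a)

/-- The identity 2-cell of a 1-cell. -/
def id {x y : S.Obj} (p : S.Word x y) : Cell p p := Quotient.mk _ (Term.id p)

/-- The inverse of a 2-cell. -/
def inv {x y : S.Obj} {p q : S.Word x y} : Cell p q → Cell q p :=
  Quotient.map Term.inv fun _ _ h => Term.Rel.inv_congr h

/-- The composition `f ⋆₁ g`. -/
def vcomp {x y : S.Obj} {p q r : S.Word x y} : Cell p q → Cell q r → Cell p r :=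
  Quotient.map₂ Term.vcomp fun _ _ h _ _ h' => Term.Rel.vcomp_congr h h'

/-- The composition `f ⋆₀ g`. -/
def hcomp {x y z : S.Obj} {p q : S.Word x y} {p' q' : S.Word y z} :
    Cell p q → Cell p' q' → Cell (p.comp p') (q.comp q') :=
  Quotient.map₂ Term.hcomp fun _ _ h _ _ h' => Term.Rel.hcomp_congr h h'

/-- The 2-cell `u f v` obtained by whiskering `f` with 1-cells `u` and `v`. -/
def whisker {x' x y y' : S.Obj} (u : S.Word x' x) {p q : S.Word x y} (f : Cell p q)
    (v : S.Word y y') : Cell (u.comp (p.comp v)) (u.comp (q.comp v)) :=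
  hcomp (id u) (hcomp f (id v))

end Cell

end TwoCells

section Brackets

variable {S}

/-- The morphism `(1, q̄) : p̄ ⟶ p̄ q̄` of the category of factorisations. -/
def right {x y z : S.Obj} (p : S.Word x y) (q : S.Word y z) : bar p ⟶ bar (p.comp q) :=
  ⟨𝟙 (pt x), proj q, by simp [bar, proj_comp]⟩

/-- The morphism `(p̄, 1) : q̄ ⟶ p̄ q̄` of the category of factorisations. -/
def left {x y z : S.Obj} (p : S.Word x y) (q : S.Word y z) : bar q ⟶ bar (p.comp q) :=
  ⟨proj p, 𝟙 (pt z), by simp [bar, proj_comp]⟩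

/-- When `q̄ = p̄`, the identity, seen as a morphism `(1, 1) : q̄ ⟶ p̄`. -/
def same {x y : S.Obj} {q p : S.Word x y} (h : proj q = proj p) : bar q ⟶ bar p :=
  ⟨𝟙 (pt x), 𝟙 (pt y), by simp [bar, h]⟩

@[simp] theorem right_l {x y z : S.Obj} (p : S.Word x y) (q : S.Word y z) :
    FactCat.Hom.l (right p q) = 𝟙 (pt x) := rfl
@[simp] theorem right_r {x y z : S.Obj} (p : S.Word x y) (q : S.Word y z) :
    FactCat.Hom.r (right p q) = proj q := rfl
@[simp] theorem left_l {x y z : S.Obj} (p : S.Word x y) (q : S.Word y z) :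
    FactCat.Hom.l (left p q) = proj p := rfl
@[simp] theorem left_r {x y z : S.Obj} (p : S.Word x y) (q : S.Word y z) :
    FactCat.Hom.r (left p q) = 𝟙 (pt z) := rfl
@[simp] theorem same_l {x y : S.Obj} {q p : S.Word x y} (h : proj q = proj p) :
    FactCat.Hom.l (same h) = 𝟙 (pt x) := rfl
@[simp] theorem same_r {x y : S.Obj} {q p : S.Word x y} (h : proj q = proj p) :
    FactCat.Hom.r (same h) = 𝟙 (pt y) := rfl

variable (S) in
/-- The family of the generating 1-cells, each seen as an arrow of the presented category. -/
abbrev gens₁ (a : Σ x y : S.Obj, (x ⟶ y)) : FactCat S.Pres := bar a.2.2.toPath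

variable (S) in
/-- The family of the generating 2-cells, each giving the arrow of the presented category that is
the common image of its source and of its target. -/
abbrev gens₂ (a : Σ x y : S.Obj, Σ p q : S.Word x y, S.Gen p q) : FactCat S.Pres := bar a.2.2.1

variable (S) in
/-- The free natural system on the generating 1-cells. -/
abbrev fnat₁ : NatSys S.Pres := freeNat S.gens₁

variable (S) in
/-- The free natural system on the generating 2-cells. -/
abbrev fnat₂ : NatSys S.Pres := freeNat S.gens₂

/-- The element `[p]` attached to a 1-cell: `[1] = 0` and `[p a] = [p] ā + p̄ [a]`. -/
def bracket₁ {x : S.Obj} : ∀ {y : S.Obj} (p : S.Word x y), S.fnat₁.obj (bar p)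
  | _, Path.nil => 0
  | _, Path.cons p a =>
      S.fnat₁.map (right p a.toPath) (bracket₁ p) +
        S.fnat₁.map (left p a.toPath) (freeNat.gen S.gens₁ ⟨_, _, a⟩)

variable (S) in
/-- The boundary map: `δ₂ [α] = [s(α)] - [t(α)]` for a generating 2-cell `α`. -/
def δ₂ : S.fnat₂ ⟶ S.fnat₁ :=
  freeNat.desc S.gens₂ S.fnat₁ fun a =>
    bracket₁ a.2.2.1 - S.fnat₁.map (same (proj_gen a.2.2.2.2).symm) (bracket₁ a.2.2.2.1)

theorem Term.proj_eq {x y : S.Obj} {p q : S.Word x y} (f : Term p q) : proj p = proj q := by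
  induction f with
  | gen a => exact proj_gen a
  | id p => rfl
  | inv f ih => exact ih.symm
  | vcomp f g ihf ihg => exact ihf.trans ihg
  | hcomp f g ihf ihg => rw [proj_comp, proj_comp, ihf, ihg]

/-- The element `[f]` attached to a formal composite of 2-cells. -/
def Term.bracket : ∀ {x y : S.Obj} {p q : S.Word x y}, Term p q → S.fnat₂.obj (bar p)
  | _, _, _, _, .gen a => freeNat.gen S.gens₂ ⟨_, _, _, _, a⟩
  | _, _, _, _, .id _ => 0
  | _, _, _, _, .inv f => - S.fnat₂.map (same f.proj_eq) f.bracket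
  | _, _, _, _, .vcomp f g => f.bracket + S.fnat₂.map (same f.proj_eq.symm) g.bracket
  | _, _, _, _, .hcomp (p := p) (p' := p') f g =>
      S.fnat₂.map (right p p') f.bracket + S.fnat₂.map (left p p') g.bracket

theorem map_map {D : NatSys S.Pres} {w w' w'' : FactCat S.Pres} (k : w ⟶ w') (k' : w' ⟶ w'')
    (a : D.obj w) : D.map k' (D.map k a) = D.map (k ≫ k') a := by
  rw [D.map_comp]; rfl

theorem Term.Rel.bracket_eq {x y : S.Obj} {p q p' q' : S.Word x y} {f : Term p q}
    {g : Term p' q'} (h : Term.Rel f g) :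
    p = p' ∧ q = q' ∧ ∀ (w : FactCat S.Pres) (k : bar p ⟶ w) (k' : bar p' ⟶ w),
      FactCat.Hom.l k = FactCat.Hom.l k' → FactCat.Hom.r k = FactCat.Hom.r k' →
      S.fnat₂.map k f.bracket = S.fnat₂.map k' g.bracket := by
  induction h with
  | refl f => exact ⟨rfl, rfl, fun w k k' hl hr => by rw [FactCat.hom_ext hl hr]⟩
  | symm _ ih =>
    exact ⟨ih.1.symm, ih.2.1.symm, fun w k k' hl hr => (ih.2.2 w k' k hl.symm hr.symm).symm⟩
  | trans _ _ ih ih' =>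
    obtain ⟨rfl, rfl, ih⟩ := ih
    exact ⟨ih'.1, ih'.2.1, fun w k k' hl hr => (ih w k k rfl rfl).trans (ih'.2.2 w k k' hl hr)⟩
  | inv_congr _ ih =>
    obtain ⟨rfl, rfl, ih⟩ := ih
    refine ⟨rfl, rfl, fun w k k' hl hr => ?_⟩
    obtain rfl := FactCat.hom_ext hl hr
    simp only [Term.bracket, map_neg, map_map]
    rw [ih w _ _ rfl rfl]
  | vcomp_congr _ _ ih ih' =>
    obtain ⟨rfl, rfl, ih⟩ := ih
    obtain ⟨_, rfl, ih'⟩ := ih'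
    refine ⟨rfl, rfl, fun w k k' hl hr => ?_⟩
    obtain rfl := FactCat.hom_ext hl hr
    simp only [Term.bracket, map_add, map_map]
    rw [ih w _ _ rfl rfl, ih' w _ _ rfl rfl]
  | hcomp_congr _ _ ih ih' =>
    obtain ⟨rfl, rfl, ih⟩ := ih
    obtain ⟨rfl, rfl, ih'⟩ := ih'
    refine ⟨rfl, rfl, fun w k k' hl hr => ?_⟩
    obtain rfl := FactCat.hom_ext hl hr
    simp only [Term.bracket, map_add, map_map]
    rw [ih w _ _ rfl rfl, ih' w _ _ rfl rfl]
  | vcomp_assoc f g h =>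
    refine ⟨rfl, rfl, fun w k k' hl hr => ?_⟩
    obtain rfl := FactCat.hom_ext hl hr
    simp only [Term.bracket, map_add, map_map, add_assoc]
    congr 3
  | id_vcomp f =>
    refine ⟨rfl, rfl, fun w k k' hl hr => ?_⟩
    obtain rfl := FactCat.hom_ext hl hr
    simp only [Term.bracket, map_map, zero_add]
    refine congrArg (fun k => S.fnat₂.map k f.bracket) (FactCat.hom_ext ?_ ?_) <;>
      simp
  | vcomp_id f =>
    refine ⟨rfl, rfl, fun w k k' hl hr => ?_⟩
    obtain rfl := FactCat.hom_ext hl hr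
    simp only [Term.bracket, map_zero, add_zero]
  | vcomp_inv f =>
    refine ⟨rfl, rfl, fun w k k' hl hr => ?_⟩
    obtain rfl := FactCat.hom_ext hl hr
    simp only [Term.bracket, map_add, map_map, map_zero, map_neg]
    rw [← sub_eq_add_neg, sub_eq_zero]
    refine congrArg (fun k => S.fnat₂.map k f.bracket) (FactCat.hom_ext ?_ ?_) <;>
      simp
  | inv_vcomp f =>
    refine ⟨rfl, rfl, fun w k k' hl hr => ?_⟩
    obtain rfl := FactCat.hom_ext hl hr
    simp only [Term.bracket, map_zero, neg_add_cancel]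
  | hcomp_assoc f g h =>
    refine ⟨Path.comp_assoc _ _ _, Path.comp_assoc _ _ _, fun w k k' hl hr => ?_⟩
    simp only [Term.bracket, map_add, map_map, add_assoc]
    congr 1
    · refine congrArg (fun k => S.fnat₂.map k f.bracket) (FactCat.hom_ext ?_ ?_) <;>
        simp [hl, hr, proj_comp]
    congr 1
    · refine congrArg (fun k => S.fnat₂.map k g.bracket) (FactCat.hom_ext ?_ ?_) <;>
        simp [hl, hr]
    · refine congrArg (fun k => S.fnat₂.map k h.bracket) (FactCat.hom_ext ?_ ?_) <;>
        simp [hl, hr, proj_comp]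
  | id_hcomp f =>
    refine ⟨Path.nil_comp _, Path.nil_comp _, fun w k k' hl hr => ?_⟩
    simp only [Term.bracket, map_map, map_zero, zero_add]
    refine congrArg (fun k => S.fnat₂.map k f.bracket) (FactCat.hom_ext ?_ ?_) <;>
      simp [hl, hr, proj_nil]
  | hcomp_id f =>
    refine ⟨rfl, rfl, fun w k k' hl hr => ?_⟩
    simp only [Term.bracket, map_map, map_zero, add_zero]
    refine congrArg (fun k => S.fnat₂.map k f.bracket) (FactCat.hom_ext ?_ ?_)
    · exact (Category.comp_id (FactCat.Hom.l k)).trans hl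
    · exact ((congrArg (· ≫ FactCat.Hom.r k) (proj_nil _)).trans (Category.id_comp _)).trans hr
  | id_hcomp_id p q =>
    refine ⟨rfl, rfl, fun w k k' hl hr => ?_⟩
    simp only [Term.bracket, map_zero, add_zero]
  | exchange f g h i =>
    refine ⟨rfl, rfl, fun w k k' hl hr => ?_⟩
    obtain rfl := FactCat.hom_ext hl hr
    simp only [Term.bracket, map_add, map_map]
    rw [add_add_add_comm]
    congr 2
    · refine congrArg (fun k => S.fnat₂.map k g.bracket) (FactCat.hom_ext ?_ ?_) <;>
        simp [h.proj_eq]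
    · refine congrArg (fun k => S.fnat₂.map k i.bracket) (FactCat.hom_ext ?_ ?_) <;>
        simp [f.proj_eq]

/-- The element `[f]` attached to a 2-cell: `[α]` is the generator for a generating 2-cell `α`,
`[1] = 0`, `[f⁻] = -[f]`, `[f ⋆₁ g] = [f] + [g]` and `[f ⋆₀ g] = [f] ḡ + f̄ [g]`. -/
def Cell.bracket {x y : S.Obj} {p q : S.Word x y} : Cell p q → S.fnat₂.obj (bar p) :=
  Quotient.lift Term.bracket fun f g h => by
    have := h.bracket_eq.2.2 _ (𝟙 _) (𝟙 _) rfl rfl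
    simp only [CategoryTheory.Functor.map_id] at this
    exact this

end Brackets

section Identities

variable {S}

namespace Cell

theorem whisker_vcomp {x' x y y' : S.Obj} (u : S.Word x' x) {p q r : S.Word x y} (f : Cell p q)
    (g : Cell q r) (v : S.Word y y') :
    whisker u (vcomp f g) v = vcomp (whisker u f v) (whisker u g v) := by
  induction f using Quotient.inductionOn with | _ f
  induction g using Quotient.inductionOn with | _ g
  refine Quotient.sound ?_
  refine Term.Rel.trans ?_ (Term.Rel.exchange _ _ _ _)
  refine Term.Rel.hcomp_congr (Term.Rel.id_vcomp _).symm ?_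
  refine Term.Rel.trans ?_ (Term.Rel.exchange _ _ _ _)
  exact Term.Rel.hcomp_congr (Term.Rel.refl _) (Term.Rel.id_vcomp _).symm

theorem vcomp_assoc {x y : S.Obj} {p q r s : S.Word x y} (f : Cell p q) (g : Cell q r)
    (h : Cell r s) : vcomp (vcomp f g) h = vcomp f (vcomp g h) := by
  induction f using Quotient.inductionOn with | _ f
  induction g using Quotient.inductionOn with | _ g
  induction h using Quotient.inductionOn with | _ h
  exact Quotient.sound (Term.Rel.vcomp_assoc f g h)

theorem id_vcomp {x y : S.Obj} {p q : S.Word x y} (f : Cell p q) : vcomp (id p) f = f := by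
  induction f using Quotient.inductionOn with | _ f
  exact Quotient.sound (Term.Rel.id_vcomp f)

theorem vcomp_id {x y : S.Obj} {p q : S.Word x y} (f : Cell p q) : vcomp f (id q) = f := by
  induction f using Quotient.inductionOn with | _ f
  exact Quotient.sound (Term.Rel.vcomp_id f)

theorem vcomp_inv {x y : S.Obj} {p q : S.Word x y} (f : Cell p q) :
    vcomp f (inv f) = id p := by
  induction f using Quotient.inductionOn with | _ f
  exact Quotient.sound (Term.Rel.vcomp_inv f)

theorem inv_vcomp {x y : S.Obj} {p q : S.Word x y} (f : Cell p q) :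
    vcomp (inv f) f = id q := by
  induction f using Quotient.inductionOn with | _ f
  exact Quotient.sound (Term.Rel.inv_vcomp f)

theorem exchange {x y z : S.Obj} {p q r : S.Word x y} {p' q' r' : S.Word y z} (f : Cell p q)
    (g : Cell q r) (h : Cell p' q') (k : Cell q' r') :
    hcomp (vcomp f g) (vcomp h k) = vcomp (hcomp f h) (hcomp g k) := by
  induction f using Quotient.inductionOn with | _ f
  induction g using Quotient.inductionOn with | _ g
  induction h using Quotient.inductionOn with | _ h
  induction k using Quotient.inductionOn with | _ k
  exact Quotient.sound (Term.Rel.exchange f g h k)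

theorem nonempty_of_proj_eq {x y : S.Obj} {p q : S.Word x y} (h : proj p = proj q) :
    Nonempty (Cell p q) := by
  have h' := (CategoryTheory.Quotient.functor_homRel_eq_compClosure_eqvGen S.homRel
    (X := x) (Y := y) p q).1 h
  induction h' with
  | rel p q h' =>
    obtain ⟨a, b, u, p, q, v, ⟨c⟩⟩ := h'
    exact ⟨whisker u (gen c) v⟩
  | refl p => exact ⟨id p⟩
  | symm p q h' ih => exact (ih (CategoryTheory.Quotient.functor_homRel_eq_compClosure_eqvGen
      S.homRel _ _ |>.2 h')).map inv
  | trans p q r h' h'' ih ih' =>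
    obtain ⟨f⟩ := ih (CategoryTheory.Quotient.functor_homRel_eq_compClosure_eqvGen
      S.homRel _ _ |>.2 h')
    obtain ⟨g⟩ := ih' (CategoryTheory.Quotient.functor_homRel_eq_compClosure_eqvGen
      S.homRel _ _ |>.2 h'')
    exact ⟨vcomp f g⟩

end Cell

/-- The closed 2-cells `f : v ⇒ v` such that `v̄ = w`. -/
structure Closed (w : FactCat S.Pres) where
  v : S.Word (ob w.src) (ob w.tgt)
  proj_v : proj v = w.arrow
  f : Cell v v

/-- The defining relations of the group of identities among relations at `w`. -/
inductive IdRel (w : FactCat S.Pres) : FreeAbelianGroup (Closed w) → Prop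
  | add (v : S.Word (ob w.src) (ob w.tgt)) (hv : proj v = w.arrow) (f g : Cell v v) :
      IdRel w (FreeAbelianGroup.of ⟨v, hv, f.vcomp g⟩ -
        (FreeAbelianGroup.of ⟨v, hv, f⟩ + FreeAbelianGroup.of ⟨v, hv, g⟩))
  | comm (v v' : S.Word (ob w.src) (ob w.tgt)) (hv : proj v = w.arrow) (hv' : proj v' = w.arrow)
      (f : Cell v v') (g : Cell v' v) :
      IdRel w (FreeAbelianGroup.of ⟨v, hv, f.vcomp g⟩ -
        FreeAbelianGroup.of ⟨v', hv', g.vcomp f⟩)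

/-- The abelian group of identities among relations at `w`: it is generated by the closed 2-cells
`f : v ⇒ v` with `v̄ = w`, subject to `⟨f ⋆₁ g⟩ = ⟨f⟩ + ⟨g⟩` for `f g : v ⇒ v` and
`⟨f ⋆₁ g⟩ = ⟨g ⋆₁ f⟩` for `f : v ⇒ v'` and `g : v' ⇒ v`. -/
abbrev IdGroup (w : FactCat S.Pres) : Type u :=
  FreeAbelianGroup (Closed w) ⧸ AddSubgroup.closure {a | IdRel w a}

/-- The class `⟨f⟩` of a closed 2-cell. -/
def Closed.cls {w : FactCat S.Pres} (c : Closed w) : IdGroup w :=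
  QuotientAddGroup.mk (FreeAbelianGroup.of c)

theorem cls_add {w : FactCat S.Pres} (v : S.Word (ob w.src) (ob w.tgt)) (hv : proj v = w.arrow)
    (f g : Cell v v) :
    Closed.cls ⟨v, hv, f.vcomp g⟩ = Closed.cls ⟨v, hv, f⟩ + Closed.cls ⟨v, hv, g⟩ := by
  have := (QuotientAddGroup.eq_zero_iff _).2 (AddSubgroup.subset_closure (IdRel.add v hv f g))
  rwa [QuotientAddGroup.mk_sub, sub_eq_zero] at this

theorem cls_comm {w : FactCat S.Pres} (v v' : S.Word (ob w.src) (ob w.tgt)) (hv : proj v = w.arrow)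
    (hv' : proj v' = w.arrow) (f : Cell v v') (g : Cell v' v) :
    Closed.cls ⟨v, hv, f.vcomp g⟩ = Closed.cls ⟨v', hv', g.vcomp f⟩ := by
  have := (QuotientAddGroup.eq_zero_iff _).2
    (AddSubgroup.subset_closure (IdRel.comm v v' hv hv' f g))
  rwa [QuotientAddGroup.mk_sub, sub_eq_zero] at this

theorem cls_congr {w : FactCat S.Pres} {v v' : S.Word (ob w.src) (ob w.tgt)} (hv : proj v = w.arrow)
    (hv' : proj v' = w.arrow) {f : Term v v} {g : Term v' v'} (h : Term.Rel f g) :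
    Closed.cls ⟨v, hv, Quotient.mk _ f⟩ = Closed.cls ⟨v', hv', Quotient.mk _ g⟩ := by
  obtain ⟨rfl, -, -⟩ := h.bracket_eq
  rw [Quotient.sound (s := Term.setoid v v) h]

/-- The image of a closed 2-cell `f` under the context `(l, r)`, computed with representatives
`p` of `l` and `q` of `r`: it is `p f q`. -/
def Closed.whisker {w w' : FactCat S.Pres} (k : w ⟶ w') (p : S.Word (ob w'.src) (ob w.src))
    (q : S.Word (ob w.tgt) (ob w'.tgt)) (hp : proj p = FactCat.Hom.l k)
    (hq : proj q = FactCat.Hom.r k) (c : Closed w) : Closed w' where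
  v := p.comp (c.v.comp q)
  proj_v := by rw [proj_comp, proj_comp, hp, hq, c.proj_v]; exact FactCat.Hom.fac k
  f := Cell.whisker p c.f q

/-- The class of `p f q` does not depend on the chosen representatives `p` and `q`. -/
theorem cls_whisker_eq {w w' : FactCat S.Pres} (k : w ⟶ w') (p p' : S.Word (ob w'.src) (ob w.src))
    (q q' : S.Word (ob w.tgt) (ob w'.tgt)) (hp : proj p = FactCat.Hom.l k)
    (hq : proj q = FactCat.Hom.r k) (hp' : proj p' = FactCat.Hom.l k)
    (hq' : proj q' = FactCat.Hom.r k) (c : Closed w) :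
    (Closed.whisker k p q hp hq c).cls = (Closed.whisker k p' q' hp' hq' c).cls := by
  obtain ⟨a⟩ := Cell.nonempty_of_proj_eq (hp.trans hp'.symm)
  obtain ⟨b⟩ := Cell.nonempty_of_proj_eq (hq.trans hq'.symm)
  obtain ⟨v, hv, f⟩ := c
  let h := Cell.hcomp a (Cell.hcomp (Cell.id v) b)
  have key : Cell.vcomp (Cell.whisker p f q) h = Cell.vcomp h (Cell.whisker p' f q') := by
    simp only [h, Cell.whisker, ← Cell.exchange, Cell.id_vcomp, Cell.vcomp_id]
  have e₁ : Cell.vcomp h (Cell.vcomp (Cell.whisker p' f q') (Cell.inv h)) =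
      Cell.whisker p f q := by
    rw [← Cell.vcomp_assoc, ← key, Cell.vcomp_assoc, Cell.vcomp_inv, Cell.vcomp_id]
  have e₂ : Cell.vcomp (Cell.vcomp (Cell.whisker p' f q') (Cell.inv h)) h =
      Cell.whisker p' f q' := by
    rw [Cell.vcomp_assoc, Cell.inv_vcomp, Cell.vcomp_id]
  have := cls_comm (p.comp (v.comp q)) (p'.comp (v.comp q')) (Closed.whisker k p q hp hq ⟨v, hv, f⟩).proj_v
    (Closed.whisker k p' q' hp' hq' ⟨v, hv, f⟩).proj_v h
    (Cell.vcomp (Cell.whisker p' f q') (Cell.inv h))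
  rw [e₁, e₂] at this
  exact this

/-- The image of a closed 2-cell under a context, for the chosen representatives. -/
noncomputable def Closed.act {w w' : FactCat S.Pres} (k : w ⟶ w') (c : Closed w) : Closed w' :=
  Closed.whisker k (rep (FactCat.Hom.l k)) (rep (FactCat.Hom.r k)) (proj_rep _) (proj_rep _) c

/-- The morphism of groups `⟨f⟩ ↦ ⟨p f q⟩` induced by a context `(p̄, q̄)`. -/
noncomputable def IdGroup.map {w w' : FactCat S.Pres} (k : w ⟶ w') : IdGroup w →+ IdGroup w' :=
  QuotientAddGroup.lift _ (FreeAbelianGroup.lift fun c : Closed w => (Closed.act k c).cls) <| by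
    rw [AddSubgroup.closure_le]
    rintro _ (⟨v, hv, f, g⟩ | ⟨v, v', hv, hv', f, g⟩)
    · simp only [SetLike.mem_coe, AddMonoidHom.mem_ker, map_sub, map_add,
        FreeAbelianGroup.lift_apply_of, sub_eq_zero, Closed.act, Closed.whisker,
        Cell.whisker_vcomp]
      exact cls_add _ _ _ _
    · simp only [SetLike.mem_coe, AddMonoidHom.mem_ker, map_sub,
        FreeAbelianGroup.lift_apply_of, sub_eq_zero, Closed.act, Closed.whisker,
        Cell.whisker_vcomp]
      exact cls_comm _ _ _ _ _ _

theorem IdGroup.map_cls {w w' : FactCat S.Pres} (k : w ⟶ w') (c : Closed w) :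
    IdGroup.map k c.cls = (Closed.act k c).cls :=
  FreeAbelianGroup.lift_apply_of _ _

theorem IdGroup.hom_ext {w : FactCat S.Pres} {A : Type*} [AddCommGroup A] {a b : IdGroup w →+ A}
    (h : ∀ c : Closed w, a c.cls = b c.cls) : a = b := by
  apply QuotientAddGroup.addMonoidHom_ext
  apply FreeAbelianGroup.lift_ext
  exact h

variable (S) in
/-- The natural system of identities among relations. -/
noncomputable def identities : NatSys S.Pres where
  obj w := AddCommGrpCat.of (IdGroup w)
  map k := AddCommGrpCat.ofHom (IdGroup.map k)
  map_id w := by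
    apply AddCommGrpCat.hom_ext
    apply IdGroup.hom_ext
    intro c
    refine (IdGroup.map_cls (𝟙 w) c).trans ?_
    refine (cls_whisker_eq (𝟙 w) _ Path.nil _ Path.nil _ _ (proj_nil _) (proj_nil _) c).trans ?_
    obtain ⟨v, hv, f⟩ := c
    induction f using Quotient.inductionOn with | _ f
    exact cls_congr _ _ ((Term.Rel.id_hcomp _).trans (Term.Rel.hcomp_id f))
  map_comp {w w' w''} k k' := by
    apply AddCommGrpCat.hom_ext
    apply IdGroup.hom_ext
    intro c
    refine (IdGroup.map_cls (k ≫ k') c).trans ?_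
    refine Eq.trans ?_ (congrArg (IdGroup.map k') (IdGroup.map_cls k c)).symm
    refine Eq.trans ?_ (IdGroup.map_cls k' _).symm
    have hl : proj ((rep (FactCat.Hom.l k')).comp (rep (FactCat.Hom.l k))) =
        FactCat.Hom.l (k ≫ k') := by
      rw [proj_comp, proj_rep, proj_rep]; rfl
    have hr : proj ((rep (FactCat.Hom.r k)).comp (rep (FactCat.Hom.r k'))) =
        FactCat.Hom.r (k ≫ k') := by
      rw [proj_comp, proj_rep, proj_rep]; rfl
    refine (cls_whisker_eq (k ≫ k') _ _ _ _ _ _ hl hr c).trans ?_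
    obtain ⟨v, hv, f⟩ := c
    induction f using Quotient.inductionOn with | _ f
    refine cls_congr _ _ ?_
    refine (Term.Rel.hcomp_congr (Term.Rel.id_hcomp_id _ _).symm
      (Term.Rel.hcomp_congr (Term.Rel.refl f) (Term.Rel.id_hcomp_id _ _).symm)).trans ?_
    refine (Term.Rel.hcomp_assoc _ _ _).trans (Term.Rel.hcomp_congr (Term.Rel.refl _) ?_)
    exact ((Term.Rel.hcomp_assoc _ _ _).trans
      (Term.Rel.hcomp_congr (Term.Rel.refl _) (Term.Rel.hcomp_assoc _ _ _))).symm

/-- The class `⟨f⟩` of a closed 2-cell `f : v ⇒ v`, in the group of identities among relations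
at `v̄`. -/
def Cell.cls {x y : S.Obj} {v : S.Word x y} (f : Cell v v) : S.identities.obj (bar v) :=
  Closed.cls (w := bar v) ⟨v, rfl, f⟩

end Identities

end TwoPolygraph

namespace TwoPolygraph

variable {S : TwoPolygraph.{u}}

/-! By induction on 2-cells, `δ₂ [f] = [s(f)] - [t(f)]` (`δ₂_bracketIn`), so closed 2-cells have
brackets in the kernel and `⟨f⟩ ↦ [f]` corestricts to it. Bijectivity is checked at each arrow `w`
separately, with maps that depend on choices and need not be natural in `w`.

Write `p̂` for the chosen representative of `p̄`. Each word `p` gets a 2-cell `N p : p ⇒ p̂` that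
reads `p` from left to right: normalise the prefix, append the next letter, apply a fixed link `l̂ a
⇒ (l ā)^`. Each `f : p ⇒ q` then yields a loop `(N p)⁻ ⋆₁ f ⋆₁ N q` at `p̂`, and `l [α] r` is sent
to the class of the loop of `u α v`, with `u`, `v` representing `l`, `r` (`loopHom`).

This is a left inverse once the class of the loop of `u f v` is known to depend on `u` and `v` only
through their images (`cls_loop_whisker_eq`). On the right, this holds because `N` is compatible
with appending letters (`cls_loop_hcomp_id`); on the left, the exchange law then forces it
(`cls_loop_hcomp_eq`). So `loopHom` takes `l [f] r` to the loop of `u f v` for every 2-cell `f`, and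
the loop of a closed `f` is conjugate to `f`.

In the other order, the composite is `1 - s δ₂`, where `s` (`stepHom`) sends `l [a] r` to the
bracket of the link `l̂ a ⇒ (l ā)^` in context `(1, r)`: the bracket of `N p` is a sum of such
links, up to the normalisation of the empty word (`bracket_loopHom`). On the kernel of `δ₂` the
correction vanishes. -/

theorem map_congr {D : NatSys S.Pres} {w w' : FactCat S.Pres} {k k' : w ⟶ w'}
    (hl : FactCat.Hom.l k = FactCat.Hom.l k') (hr : FactCat.Hom.r k = FactCat.Hom.r k')
    (a : D.obj w) : D.map k a = D.map k' a := by
  rw [FactCat.hom_ext hl hr]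

/-- The identity `(1, 1)`, seen as a morphism `p̄ ⟶ w` when `p̄ = w`. -/
def toArrow {w : FactCat S.Pres} (p : S.Word (ob w.src) (ob w.tgt)) (h : proj p = w.arrow) :
    bar p ⟶ w :=
  ⟨𝟙 w.src, 𝟙 w.tgt, (Category.id_comp _).trans ((Category.comp_id _).trans h)⟩

@[simp] theorem toArrow_l {w : FactCat S.Pres} (p : S.Word (ob w.src) (ob w.tgt))
    (h : proj p = w.arrow) : FactCat.Hom.l (toArrow p h) = 𝟙 w.src := rfl

@[simp] theorem toArrow_r {w : FactCat S.Pres} (p : S.Word (ob w.src) (ob w.tgt))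
    (h : proj p = w.arrow) : FactCat.Hom.r (toArrow p h) = 𝟙 w.tgt := rfl

theorem toArrow_rfl {x y : S.Obj} (p : S.Word x y) :
    toArrow (w := bar p) p rfl = 𝟙 (bar p) := rfl

/-! ### One-dimensional brackets -/

theorem map_bracket₁_comp_toPath {x y z : S.Obj} (p : S.Word x y) (a : y ⟶ z)
    {w : FactCat S.Pres} (k : bar (p.comp a.toPath) ⟶ w) :
    S.fnat₁.map k (bracket₁ (p.comp a.toPath)) =
      S.fnat₁.map (right p a.toPath ≫ k) (bracket₁ p) +
        S.fnat₁.map (left p a.toPath ≫ k) (freeNat.gen S.gens₁ ⟨_, _, a⟩) :=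
  (map_add (S.fnat₁.map k).hom _ _).trans (congrArg₂ _ (map_map _ _ _) (map_map _ _ _))

/-- The bracket is a derivation; since it recurses on the last letter, the induction is on `q`. The
contexts `k₁`, `k₂` are constrained only by their components, so that callers may supply any
morphisms with the right left and right factors. -/
theorem map_bracket₁_comp {x y z : S.Obj} (p : S.Word x y) (q : S.Word y z)
    {w : FactCat S.Pres} (k : bar (p.comp q) ⟶ w) (k₁ : bar p ⟶ w) (k₂ : bar q ⟶ w)
    (hl₁ : FactCat.Hom.l k₁ = FactCat.Hom.l k) (hr₁ : FactCat.Hom.r k₁ = proj q ≫ FactCat.Hom.r k)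
    (hl₂ : FactCat.Hom.l k₂ = FactCat.Hom.l k ≫ proj p)
    (hr₂ : FactCat.Hom.r k₂ = FactCat.Hom.r k) :
    S.fnat₁.map k (bracket₁ (p.comp q)) =
      S.fnat₁.map k₁ (bracket₁ p) + S.fnat₁.map k₂ (bracket₁ q) := by
  induction q with
  | nil =>
    rw [bracket₁, map_zero, add_zero]
    refine map_congr hl₁.symm ?_ _
    exact (hr₁.trans ((congrArg (· ≫ FactCat.Hom.r k) (proj_nil _)).trans
      (Category.id_comp _))).symm
  | @cons z t q a ih =>
    have e₁ := map_bracket₁_comp_toPath (p.comp q) a k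
    have e₂ := map_bracket₁_comp_toPath q a k₂
    have h : proj (q.cons a) = proj q ≫ proj a.toPath := proj_comp q a.toPath
    refine e₁.trans ?_
    refine Eq.trans ?_ (congrArg _ e₂).symm
    rw [← add_assoc, ih (right (p.comp q) a.toPath ≫ k) (right q a.toPath ≫ k₂)]
    · congr 1
      refine map_congr ?_ (congrArg (𝟙 _ ≫ ·) hr₂.symm) _
      refine Eq.trans ?_ (congrArg (· ≫ proj q) hl₂.symm)
      exact (congrArg (FactCat.Hom.l k ≫ ·) (proj_comp p q)).trans (Category.assoc _ _ _).symm
    · exact hl₁.trans (Category.comp_id (FactCat.Hom.l k)).symm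
    · exact hr₁.trans ((congrArg (· ≫ FactCat.Hom.r k) h).trans (Category.assoc _ _ _))
    · exact (Category.comp_id (FactCat.Hom.l k₂)).trans
        (hl₂.trans (congrArg (· ≫ proj p) (Category.comp_id (FactCat.Hom.l k)).symm))
    · exact congrArg (proj a.toPath ≫ ·) hr₂

/-! ### Brackets of 2-cells in context -/

namespace Cell

theorem proj_eq {x y : S.Obj} {p q : S.Word x y} (f : Cell p q) : proj p = proj q := by
  induction f using Quotient.inductionOn with | _ f
  exact f.proj_eq

/-- The element `l [f] r` attached to a 2-cell `f` and a context `k = (l, r)`. -/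
def bracketIn {x y : S.Obj} {p q : S.Word x y} (f : Cell p q) {w : FactCat S.Pres}
    (k : bar p ⟶ w) : S.fnat₂.obj w := S.fnat₂.map k f.bracket

theorem bracketIn_congr {x y : S.Obj} {p q : S.Word x y} (f : Cell p q) {w : FactCat S.Pres}
    {k k' : bar p ⟶ w} (hl : FactCat.Hom.l k = FactCat.Hom.l k')
    (hr : FactCat.Hom.r k = FactCat.Hom.r k') : f.bracketIn k = f.bracketIn k' :=
  map_congr hl hr _

theorem map_bracketIn {x y : S.Obj} {p q : S.Word x y} (f : Cell p q) {w w' : FactCat S.Pres}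
    (k : bar p ⟶ w) (k' : w ⟶ w') : S.fnat₂.map k' (f.bracketIn k) = f.bracketIn (k ≫ k') :=
  map_map _ _ _

theorem bracketIn_id {x y : S.Obj} (p : S.Word x y) {w : FactCat S.Pres} (k : bar p ⟶ w) :
    (id p).bracketIn k = 0 := map_zero _

theorem bracketIn_gen {x y : S.Obj} {p q : S.Word x y} (a : S.Gen p q) {w : FactCat S.Pres}
    (k : bar p ⟶ w) : (gen a).bracketIn k =
      FreeAbelianGroup.of (⟨⟨_, _, _, _, a⟩, k⟩ : Σ i, (S.gens₂ i ⟶ w)) := by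
  refine (FreeAbelianGroup.map_of_apply _).trans ?_
  exact congrArg (fun k => FreeAbelianGroup.of (⟨⟨_, _, _, _, a⟩, k⟩ : Σ i, (S.gens₂ i ⟶ w)))
    (Category.id_comp k)

/-- Pushing all brackets into a common fibre at `w` confines the transport between the fibres at
`p̄` and `q̄` to the contexts, where it is the harmless factor `same`. -/
theorem bracketIn_vcomp {x y : S.Obj} {p q r : S.Word x y} (f : Cell p q) (g : Cell q r)
    {w : FactCat S.Pres} (k : bar p ⟶ w) :
    (vcomp f g).bracketIn k = f.bracketIn k + g.bracketIn (same f.proj_eq.symm ≫ k) := by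
  induction f using Quotient.inductionOn with | _ f
  induction g using Quotient.inductionOn with | _ g
  refine (map_add (S.fnat₂.map k).hom _ _).trans ?_
  exact congrArg _ (map_map _ _ _)

theorem bracketIn_inv {x y : S.Obj} {p q : S.Word x y} (f : Cell p q)
    {w : FactCat S.Pres} (k : bar q ⟶ w) :
    (inv f).bracketIn k = - f.bracketIn (same f.proj_eq ≫ k) := by
  induction f using Quotient.inductionOn with | _ f
  refine (map_neg (S.fnat₂.map k).hom _).trans ?_
  exact congrArg _ (map_map _ _ _)

theorem bracketIn_hcomp {x y z : S.Obj} {p q : S.Word x y} {p' q' : S.Word y z} (f : Cell p q)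
    (g : Cell p' q') {w : FactCat S.Pres} (k : bar (p.comp p') ⟶ w) :
    (hcomp f g).bracketIn k = f.bracketIn (right p p' ≫ k) + g.bracketIn (left p p' ≫ k) := by
  induction f using Quotient.inductionOn with | _ f
  induction g using Quotient.inductionOn with | _ g
  refine (map_add (S.fnat₂.map k).hom _ _).trans ?_
  exact congrArg₂ _ (map_map _ _ _) (map_map _ _ _)

theorem bracketIn_whisker {x' x y y' : S.Obj} (u : S.Word x' x) {p q : S.Word x y} (f : Cell p q)
    (v : S.Word y y') {w : FactCat S.Pres} (k : bar (u.comp (p.comp v)) ⟶ w) :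
    (whisker u f v).bracketIn k = f.bracketIn (right p v ≫ left u (p.comp v) ≫ k) := by
  rw [whisker, bracketIn_hcomp, bracketIn_hcomp, bracketIn_id, bracketIn_id, zero_add, add_zero]

end Cell

/-! ### The morphism `⟨f⟩ ↦ [f]` -/

/-- The morphism of groups `⟨f⟩ ↦ [f]` at `w`. -/
def IdGroup.bracket (w : FactCat S.Pres) : IdGroup w →+ S.fnat₂.obj w :=
  QuotientAddGroup.lift _
    (FreeAbelianGroup.lift fun c : Closed w => c.f.bracketIn (toArrow c.v c.proj_v)) <| by
    rw [AddSubgroup.closure_le]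
    rintro _ (⟨v, hv, f, g⟩ | ⟨v, v', hv, hv', f, g⟩)
    · simp only [SetLike.mem_coe, AddMonoidHom.mem_ker, map_sub, map_add,
        FreeAbelianGroup.lift_apply_of, sub_eq_zero, Cell.bracketIn_vcomp]
      rfl
    · simp only [SetLike.mem_coe, AddMonoidHom.mem_ker, map_sub,
        FreeAbelianGroup.lift_apply_of, sub_eq_zero, Cell.bracketIn_vcomp]
      -- Cyclic invariance holds because brackets add in an abelian group; the remaining contexts
      -- differ only by identities.
      rw [add_comm]
      refine congrArg₂ _ ?_ ?_
      · exact Cell.bracketIn_congr _ (Category.id_comp (𝟙 w.src)) (Category.id_comp (𝟙 w.tgt))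
      · exact Cell.bracketIn_congr _ (Category.id_comp (𝟙 w.src)).symm
          (Category.id_comp (𝟙 w.tgt)).symm

theorem IdGroup.bracket_cls {w : FactCat S.Pres} (c : Closed w) :
    IdGroup.bracket w c.cls = c.f.bracketIn (toArrow c.v c.proj_v) :=
  FreeAbelianGroup.lift_apply_of _ _

theorem IdGroup.bracket_map {w w' : FactCat S.Pres} (k : w ⟶ w') (a : IdGroup w) :
    IdGroup.bracket w' (IdGroup.map k a) = S.fnat₂.map k (IdGroup.bracket w a) := by
  suffices (IdGroup.bracket w').comp (IdGroup.map k) =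
      (S.fnat₂.map k).hom.comp (IdGroup.bracket w) from DFunLike.congr_fun this a
  apply IdGroup.hom_ext
  intro c
  refine (congrArg _ (IdGroup.map_cls k c)).trans ((IdGroup.bracket_cls _).trans ?_)
  refine Eq.trans ?_ (congrArg (S.fnat₂.map k).hom (IdGroup.bracket_cls c)).symm
  refine Eq.trans ?_ (Cell.map_bracketIn _ _ _).symm
  refine (Cell.bracketIn_whisker _ _ _ _).trans (Cell.bracketIn_congr _ ?_ ?_)
  · refine (congrArg (fun a => (𝟙 w'.src ≫ a) ≫ 𝟙 w.src) (proj_rep (FactCat.Hom.l k))).trans ?_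
    simp
  · refine (congrArg (fun a => a ≫ 𝟙 w'.tgt ≫ 𝟙 w'.tgt) (proj_rep (FactCat.Hom.r k))).trans ?_
    simp

variable (S) in
/-- The morphism of natural systems `⟨f⟩ ↦ [f]`. -/
noncomputable def bracketHom : S.identities ⟶ S.fnat₂ where
  app w := AddCommGrpCat.ofHom (IdGroup.bracket w)
  naturality w w' k := by
    apply AddCommGrpCat.hom_ext
    ext a
    exact IdGroup.bracket_map k a

theorem bracketHom_cls {x y : S.Obj} {v : S.Word x y} (f : Cell v v) :
    S.bracketHom.app (bar v) f.cls = f.bracket := by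
  refine (IdGroup.bracket_cls _).trans ?_
  exact (congrArg (fun k => S.fnat₂.map k f.bracket) (toArrow_rfl v)).trans
    (DFunLike.congr_fun (congrArg AddCommGrpCat.Hom.hom (S.fnat₂.map_id (bar v))) f.bracket)

/-! ### The boundary of a bracket -/

theorem δ₂_gen {x y : S.Obj} {p q : S.Word x y} (a : S.Gen p q) {w : FactCat S.Pres}
    (k : bar p ⟶ w) : S.δ₂.app w ((Cell.gen a).bracketIn k) =
      S.fnat₁.map k (bracket₁ p) - S.fnat₁.map (same (proj_gen a).symm ≫ k) (bracket₁ q) := by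
  rw [Cell.bracketIn_gen]
  refine (FreeAbelianGroup.lift_apply_of _ _).trans ?_
  exact (map_sub (S.fnat₁.map k).hom _ _).trans (congrArg _ (map_map _ _ _))

/-- Vertical composites telescope and horizontal ones follow from the derivation rule. The contexts
`k` and `k'` have equal factors but different sources, `p̄` and `q̄` being only propositionally
equal. -/
theorem δ₂_bracketIn {x y : S.Obj} {p q : S.Word x y} (f : Cell p q) {w : FactCat S.Pres}
    (k : bar p ⟶ w) (k' : bar q ⟶ w) (hl : FactCat.Hom.l k = FactCat.Hom.l k')
    (hr : FactCat.Hom.r k = FactCat.Hom.r k') : S.δ₂.app w (f.bracketIn k) =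
      S.fnat₁.map k (bracket₁ p) - S.fnat₁.map k' (bracket₁ q) := by
  induction f using Quotient.inductionOn with | _ f
  induction f generalizing w with
  | gen a =>
    refine (δ₂_gen a k).trans ?_
    congr 1
    refine map_congr ?_ ?_ _ <;> simp [hl, hr]
  | id p =>
    obtain rfl := FactCat.hom_ext hl hr
    rw [sub_self]
    exact (congrArg _ (Cell.bracketIn_id p k)).trans (map_zero _)
  | inv f ih =>
    refine (congrArg _ (Cell.bracketIn_inv (Quotient.mk _ f) k)).trans ((map_neg _ _).trans ?_)
    rw [ih (same f.proj_eq ≫ k) k (by simp) (by simp), neg_sub]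
    congr 1
    refine map_congr ?_ ?_ _ <;> simp [hl, hr]
  | vcomp f g ihf ihg =>
    refine (congrArg _ (Cell.bracketIn_vcomp (Quotient.mk _ f) (Quotient.mk _ g) k)).trans
      ((map_add _ _ _).trans ?_)
    rw [ihf k (same f.proj_eq.symm ≫ k) (by simp) (by simp),
      ihg (same f.proj_eq.symm ≫ k) k' (by simp [hl]) (by simp [hr]), sub_add_sub_cancel]
  | @hcomp _ _ _ p q p' q' f g ihf ihg =>
    refine (congrArg _ (Cell.bracketIn_hcomp (Quotient.mk _ f) (Quotient.mk _ g) k)).trans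
      ((map_add _ _ _).trans ?_)
    -- On the target side the contexts are built from `q` and `q'`; they agree with those built from
    -- `p` and `p'` because 2-cells preserve images.
    rw [ihf (right p p' ≫ k) (right q q' ≫ k') (by simp [hl]) (by simp [hr, g.proj_eq]),
      ihg (left p p' ≫ k) (left q q' ≫ k') (by simp [hl, f.proj_eq]) (by simp [hr]),
      map_bracket₁_comp p p' k (right p p' ≫ k) (left p p' ≫ k) (by simp) (by simp) (by simp)
        (by simp),
      map_bracket₁_comp q q' k' (right q q' ≫ k') (left q q' ≫ k') (by simp) (by simp) (by simp)
        (by simp)]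
    abel

theorem bracketHom_δ₂ : S.bracketHom ≫ S.δ₂ = 0 := by
  ext w a
  suffices (S.δ₂.app w).hom.comp (IdGroup.bracket w) = 0 from DFunLike.congr_fun this a
  apply IdGroup.hom_ext
  intro c
  refine (congrArg (S.δ₂.app w).hom (IdGroup.bracket_cls c)).trans ?_
  refine (δ₂_bracketIn c.f _ (toArrow c.v c.proj_v) rfl rfl).trans ?_
  rw [sub_self]
  rfl

/-! ### A normalisation strategy compatible with composition on the right -/

namespace Cell

/-- A chosen 2-cell between 1-cells with the same image in the presented category. -/
noncomputable def link {x y : S.Obj} (p q : S.Word x y) (h : proj p = proj q) : Cell p q :=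
  (nonempty_of_proj_eq h).some

theorem proj_comp_rep {x y z : S.Obj} (p : S.Word x y) (a : y ⟶ z) {w : pt x ⟶ pt z}
    (h : proj (p.cons a) = w) : proj ((rep (proj p)).comp a.toPath) = proj (rep w) := by
  rw [proj_rep, proj_comp, proj_rep, ← h]
  exact (proj_comp p a.toPath).symm

/-- A 2-cell from `p` to the chosen representative of `w = p̄`, obtained by normalising `p` from
the left to the right. -/
noncomputable def normalise {x : S.Obj} :
    ∀ {y : S.Obj} (p : S.Word x y) (w : pt x ⟶ pt y), proj p = w → Cell p (rep w)
  -- The representative of an identity need not be the empty path, so a link is needed here too.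
  | _, Path.nil, w, h => link Path.nil (rep w) (h.trans (proj_rep w).symm)
  -- The final link sees the prefix `p` only through `proj p`; this is the source of the
  -- compatibility with composition on the right.
  | _, Path.cons p a, w, h =>
      vcomp (hcomp (normalise p (proj p) rfl) (id a.toPath))
        (link ((rep (proj p)).comp a.toPath) (rep w) (proj_comp_rep p a h))

/-- The closed 2-cell at the chosen representative of `w` obtained from `f : p ⇒ q` by normalising
its source and its target. -/
noncomputable def loop {w : FactCat S.Pres} {p q : S.Word (ob w.src) (ob w.tgt)} (f : Cell p q)
    (hp : proj p = w.arrow) (hq : proj q = w.arrow) : Closed w :=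
  ⟨rep w.arrow, proj_rep _,
    vcomp (inv (normalise p w.arrow hp)) (vcomp f (normalise q w.arrow hq))⟩

/-! ### Calculus of loop classes. -/

variable {w : FactCat S.Pres}

/-- The normalisation of the intermediate word `q` cancels against its inverse. -/
theorem cls_loop_vcomp {p q r : S.Word (ob w.src) (ob w.tgt)} (f : Cell p q) (g : Cell q r)
    (hp : proj p = w.arrow) (hq : proj q = w.arrow) (hr : proj r = w.arrow) :
    ((vcomp f g).loop hp hr).cls = (f.loop hp hq).cls + (g.loop hq hr).cls := by
  refine Eq.trans ?_ (cls_add _ _ _ _)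
  refine congrArg (fun f => Closed.cls (w := w) ⟨rep w.arrow, proj_rep _, f⟩) ?_
  rw [vcomp_assoc, vcomp_assoc, vcomp_assoc,
    ← vcomp_assoc (normalise q w.arrow hq) (inv (normalise q w.arrow hq)), vcomp_inv, id_vcomp]

theorem cls_loop_id (p : S.Word (ob w.src) (ob w.tgt)) (hp : proj p = w.arrow) :
    ((id p).loop hp hp).cls = 0 := by
  have h := cls_loop_vcomp (id p) (id p) hp hp hp
  rw [id_vcomp] at h
  exact left_eq_add.1 h

theorem cls_loop_inv {p q : S.Word (ob w.src) (ob w.tgt)} (f : Cell p q)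
    (hp : proj p = w.arrow) (hq : proj q = w.arrow) :
    ((inv f).loop hq hp).cls = - (f.loop hp hq).cls := by
  rw [eq_neg_iff_add_eq_zero, ← cls_loop_vcomp, inv_vcomp, cls_loop_id]

theorem cls_loop_congr {p q p' q' : S.Word (ob w.src) (ob w.tgt)} {f : Term p q} {g : Term p' q'}
    (h : Term.Rel f g) (hp : proj p = w.arrow) (hq : proj q = w.arrow) (hp' : proj p' = w.arrow)
    (hq' : proj q' = w.arrow) :
    (loop (Quotient.mk _ f) hp hq).cls = (loop (Quotient.mk _ g) hp' hq').cls := by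
  obtain ⟨rfl, rfl, -⟩ := h.bracket_eq
  rw [Quotient.sound (s := Term.setoid p q) h]

/-- For closed `f` the loop is a conjugate of `f`, and the cyclic relation makes conjugation
invisible. -/
theorem cls_loop_closed {p : S.Word (ob w.src) (ob w.tgt)} (f : Cell p p)
    (hp : proj p = w.arrow) : (f.loop hp hp).cls = Closed.cls ⟨p, hp, f⟩ := by
  refine (cls_comm _ _ _ hp _ _).trans ?_
  rw [vcomp_assoc, vcomp_inv, vcomp_id]

/-- The morphism `(1, x̄) : w ⟶ w x̄` of the category of factorisations. -/
def extend {a b c : S.Pres} (w : a ⟶ b) (r : b ⟶ c) {w' : a ⟶ c} (h : w ≫ r = w') :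
    (⟨a, b, w⟩ : FactCat S.Pres) ⟶ ⟨a, c, w'⟩ :=
  ⟨𝟙 a, r, (Category.id_comp _).trans h⟩

/-! ### Loops and composition on the right. -/

theorem vcomp_left_cancel {x y : S.Obj} {p q r : S.Word x y} (f : Cell p q) {g g' : Cell q r}
    (h : vcomp f g = vcomp f g') : g = g' := by
  rw [← id_vcomp g, ← inv_vcomp f, vcomp_assoc, h, ← vcomp_assoc, inv_vcomp, id_vcomp]

theorem cls_eq_of_vcomp_eq {v v' : S.Word (ob w.src) (ob w.tgt)} (hv : proj v = w.arrow)
    (hv' : proj v' = w.arrow) {f : Cell v v} {g : Cell v' v'} (h : Cell v v')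
    (e : vcomp f h = vcomp h g) : Closed.cls ⟨v, hv, f⟩ = Closed.cls ⟨v', hv', g⟩ := by
  have := cls_comm v v' hv hv' h (vcomp g (inv h))
  rwa [← vcomp_assoc, ← e, vcomp_assoc, vcomp_inv, vcomp_id, vcomp_assoc, inv_vcomp,
    vcomp_id] at this

theorem normalise_comp_toPath {x y z : S.Obj} (p : S.Word x y) (a : y ⟶ z) {v : pt x ⟶ pt y}
    {v' : pt x ⟶ pt z} (hp : proj p = v) (hp' : proj (p.comp a.toPath) = v')
    (h : proj ((rep v).comp a.toPath) = proj (rep v')) :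
    normalise (p.comp a.toPath) v' hp' = vcomp (hcomp (normalise p v hp) (id a.toPath))
      (link ((rep v).comp a.toPath) (rep v') h) := by
  subst hp
  rfl

theorem cls_whisker_nil {x y : S.Obj} {z : S.Obj} (r : S.Word y z) {v : pt x ⟶ pt y}
    {v' : pt x ⟶ pt z} (h : v ≫ proj r = v') (c : Closed (S := S) ⟨pt x, pt y, v⟩)
    (hc : proj (c.v.comp r) = v') :
    (Closed.whisker (extend v (proj r) h) Path.nil r (proj_nil _) rfl c).cls =
      Closed.cls (w := ⟨pt x, pt z, v'⟩) ⟨c.v.comp r, hc, hcomp c.f (id r)⟩ := by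
  obtain ⟨u, hu, f⟩ := c
  induction f using Quotient.inductionOn with | _ f
  exact cls_congr _ _ (Term.Rel.id_hcomp _)

/-- With `g`, `g'` the normalisations of `p`, `q` and `h` the link that follows them, this exhibits
the loop of `f s` as the conjugate by `h` of the loop of `f` composed with `s`. -/
theorem hcomp_id_conj {x y z : S.Obj} {p q r : S.Word x y} (f : Cell p q) (g : Cell p r)
    (g' : Cell q r) (s : S.Word y z) {t : S.Word x z} (h : Cell (r.comp s) t) :
    vcomp (hcomp (vcomp (inv g) (vcomp f g')) (id s)) h =
      vcomp h (vcomp (inv (vcomp (hcomp g (id s)) h))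
        (vcomp (hcomp f (id s)) (vcomp (hcomp g' (id s)) h))) := by
  have e : ∀ {p q r : S.Word x y} (f : Cell p q) (g : Cell q r),
      vcomp (hcomp f (id s)) (hcomp g (id s)) = hcomp (vcomp f g) (id s) := fun f g => by
    rw [← exchange, id_vcomp]
  apply vcomp_left_cancel (hcomp g (id s))
  rw [← vcomp_assoc (hcomp g (id s)) h,
    ← vcomp_assoc (vcomp (hcomp g (id s)) h) (inv (vcomp (hcomp g (id s)) h)), vcomp_inv, id_vcomp]
  simp only [← vcomp_assoc, e, vcomp_inv, id_vcomp]

theorem cls_hcomp_id_nil {v : S.Word (ob w.src) (ob w.tgt)} (f : Cell v v)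
    (hv : proj v = w.arrow) (hv' : proj (v.comp Path.nil) = w.arrow) :
    Closed.cls ⟨v.comp Path.nil, hv', hcomp f (id Path.nil)⟩ = Closed.cls ⟨v, hv, f⟩ := by
  induction f using Quotient.inductionOn with | _ f
  exact cls_congr _ _ (Term.Rel.hcomp_id f)

/-- As `p̄ = q̄`, the normalisations of `p a` and `q a` end with the same link, so the loop of `f a`
is conjugate by this link to the loop of `f` composed with `a`. -/
theorem cls_loop_hcomp_toPath {x y z : S.Obj} {p q : S.Word x y} (f : Cell p q) (a : y ⟶ z)
    {v : pt x ⟶ pt y} {v' : pt x ⟶ pt z} (hp : proj p = v) (hq : proj q = v)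
    (h : v ≫ proj a.toPath = v')
    (hp' : proj (p.comp a.toPath) = v') (hq' : proj (q.comp a.toPath) = v') :
    (loop (w := ⟨pt x, pt z, v'⟩) (hcomp f (id a.toPath)) hp' hq').cls =
      IdGroup.map (extend v (proj a.toPath) h) (loop (w := ⟨pt x, pt y, v⟩) f hp hq).cls := by
  have hv : proj ((rep v).comp a.toPath) = v' := by rw [proj_comp, proj_rep, h]
  refine Eq.symm ((IdGroup.map_cls _ _).trans ?_)
  refine (cls_whisker_eq (extend v (proj a.toPath) h) _ Path.nil _ a.toPath _ _ (proj_nil _)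
    rfl _).trans ?_
  refine (cls_whisker_nil a.toPath h _ hv).trans ?_
  refine cls_eq_of_vcomp_eq _ _ (link _ _ (hv.trans (proj_rep v').symm)) ?_
  have e := normalise_comp_toPath p a hp hp' (hv.trans (proj_rep v').symm)
  have e' := normalise_comp_toPath q a hq hq' (hv.trans (proj_rep v').symm)
  refine (hcomp_id_conj f (normalise p v hp) (normalise q v hq) a.toPath _).trans ?_
  exact congrArg₂ (fun A B => vcomp _ (vcomp (inv A) (vcomp _ B))) e.symm e'.symm

theorem cls_loop_hcomp_id {x y z : S.Obj} {p q : S.Word x y} (f : Cell p q) (r : S.Word y z)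
    {v : pt x ⟶ pt y} {v' : pt x ⟶ pt z} (hp : proj p = v) (hq : proj q = v)
    (h : v ≫ proj r = v') (hp' : proj (p.comp r) = v') (hq' : proj (q.comp r) = v') :
    (loop (w := ⟨pt x, pt z, v'⟩) (hcomp f (id r)) hp' hq').cls =
      IdGroup.map (extend v (proj r) h) (loop (w := ⟨pt x, pt y, v⟩) f hp hq).cls := by
  induction r with
  | nil =>
    obtain rfl : v = v' := (Category.comp_id v).symm.trans
      ((congrArg (v ≫ ·) (proj_nil y).symm).trans h)
    refine Eq.symm ((IdGroup.map_cls _ _).trans ?_)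
    refine (cls_whisker_eq (extend v (proj Path.nil) h) _ Path.nil _ Path.nil _ _ (proj_nil _)
      rfl _).trans ?_
    refine (cls_whisker_nil Path.nil h (loop (w := ⟨pt x, pt y, v⟩) f hp hq) (proj_rep v)).trans ?_
    refine Eq.trans (b := (loop (w := ⟨pt x, pt y, v⟩) f hp hq).cls) ?_ ?_
    · exact cls_hcomp_id_nil (w := ⟨pt x, pt y, v⟩) _ _ _
    · induction f using Quotient.inductionOn with | _ f
      exact (cls_loop_congr (Term.Rel.hcomp_id f) _ _ _ _).symm
  | @cons z t r a ih =>
    have hr : proj (r.cons a) = proj r ≫ proj a.toPath := proj_comp r a.toPath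
    have h' : (v ≫ proj r) ≫ proj a.toPath = v' := by rw [Category.assoc, ← hr, h]
    have ep : proj (p.comp r) = v ≫ proj r := by rw [proj_comp, hp]
    have eq : proj (q.comp r) = v ≫ proj r := by rw [proj_comp, hq]
    refine Eq.trans (b := (loop (w := ⟨pt x, pt t, v'⟩) (hcomp (hcomp f (id r)) (id a.toPath))
      hp' hq').cls) ?_ ?_
    · induction f using Quotient.inductionOn with | _ f
      exact cls_loop_congr (w := ⟨pt x, pt t, v'⟩)
        (f := Term.hcomp f (Term.id (r.comp a.toPath)))
        (g := Term.hcomp (Term.hcomp f (Term.id r)) (Term.id a.toPath))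
        ((Term.Rel.hcomp_congr (Term.Rel.refl _)
        (Term.Rel.id_hcomp_id _ _).symm).trans (Term.Rel.hcomp_assoc _ _ _).symm) _ _ _ _
    · rw [cls_loop_hcomp_toPath (hcomp f (id r)) a ep eq h' hp' hq', ih rfl ep eq]
      refine (map_map (D := S.identities) _ _ _).trans (map_congr (D := S.identities) ?_ ?_ _)
      · exact Category.comp_id (𝟙 (pt x))
      · exact hr.symm

/-! ### Loops of whiskered 2-cells -/

variable {x y z : S.Obj}

theorem hcomp_eq_left {p q : S.Word x y} {p' q' : S.Word y z} (f : Cell p q) (g : Cell p' q') :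
    vcomp (hcomp f (id p')) (hcomp (id q) g) = hcomp f g := by
  rw [← exchange, vcomp_id, id_vcomp]

theorem hcomp_eq_right {p q : S.Word x y} {p' q' : S.Word y z} (f : Cell p q) (g : Cell p' q') :
    vcomp (hcomp (id p) g) (hcomp f (id q')) = hcomp f g := by
  rw [← exchange, vcomp_id, id_vcomp]

theorem whisker_id {t : S.Obj} (u : S.Word z x) (p : S.Word x y) (v : S.Word y t) :
    whisker u (id p) v = id _ := by
  refine Quotient.sound ?_
  exact (Term.Rel.hcomp_congr (Term.Rel.refl _) (Term.Rel.id_hcomp_id _ _)).trans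
    (Term.Rel.id_hcomp_id _ _)

theorem whisker_inv {t : S.Obj} (u : S.Word z x) {p q : S.Word x y} (f : Cell p q)
    (v : S.Word y t) : whisker u (inv f) v = inv (whisker u f v) := by
  refine vcomp_left_cancel (whisker u f v) ?_
  rw [vcomp_inv, ← whisker_vcomp, vcomp_inv, whisker_id]

/-- The loop of a composite `f r` depends on `r` only through its image. -/
theorem cls_loop_hcomp_id_eq {p q : S.Word (ob w.src) y} (f : Cell p q) {r r' : S.Word y (ob w.tgt)}
    (hr : proj r = proj r') (hp : proj (p.comp r) = w.arrow) (hq : proj (q.comp r) = w.arrow)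
    (hp' : proj (p.comp r') = w.arrow) (hq' : proj (q.comp r') = w.arrow) :
    (loop (hcomp f (id r)) hp hq).cls = (loop (hcomp f (id r')) hp' hq').cls := by
  obtain ⟨⟨a⟩, ⟨b⟩, w⟩ := w
  have h : proj p ≫ proj r = w := (proj_comp p r).symm.trans hp
  have h' : proj p ≫ proj r' = w := (proj_comp p r').symm.trans hp'
  rw [cls_loop_hcomp_id f r rfl f.proj_eq.symm h hp hq,
    cls_loop_hcomp_id f r' rfl f.proj_eq.symm h' hp' hq']
  exact map_congr (D := S.identities) (k := extend (proj p) (proj r) h)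
    (k' := extend (proj p) (proj r') h') rfl hr _

/-- The two factorisations of `f ⋆₀ g` give `f r` followed by `q g`, or `p g` followed by `f r'`.
The loops of `f r` and `f r'` have equal classes by independence on the right, and they cancel. -/
theorem cls_loop_hcomp_eq {p q : S.Word (ob w.src) y} {r r' : S.Word y (ob w.tgt)} (f : Cell p q)
    (g : Cell r r') (hp : proj (p.comp r) = w.arrow) (hq : proj (q.comp r) = w.arrow)
    (hr : proj (p.comp r') = w.arrow) (hr' : proj (q.comp r') = w.arrow) :
    (loop (hcomp (id p) g) hp hr).cls = (loop (hcomp (id q) g) hq hr').cls := by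
  have h := (cls_loop_vcomp (hcomp f (id r)) (hcomp (id q) g) hp hq hr').symm
  rw [hcomp_eq_left f g, ← hcomp_eq_right f g, cls_loop_vcomp _ _ hp hr hr',
    cls_loop_hcomp_id_eq f g.proj_eq hp hq hr hr', add_comm] at h
  exact (add_right_cancel h).symm

/-- The loop of `u f v` depends on `u` and `v` only through their images. -/
theorem cls_loop_whisker_eq {p q : S.Word x y} (f : Cell p q) {u u' : S.Word (ob w.src) x}
    {v v' : S.Word y (ob w.tgt)} (hu : proj u = proj u') (hv : proj v = proj v')
    (hp : proj (u.comp (p.comp v)) = w.arrow) (hq : proj (u.comp (q.comp v)) = w.arrow)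
    (hp' : proj (u'.comp (p.comp v')) = w.arrow) (hq' : proj (u'.comp (q.comp v')) = w.arrow) :
    (loop (whisker u f v) hp hq).cls = (loop (whisker u' f v') hp' hq').cls := by
  have hp₁ : proj (u'.comp (p.comp v)) = w.arrow := by rw [← hp, proj_comp, proj_comp u, hu]
  have hq₁ : proj (u'.comp (q.comp v)) = w.arrow := by rw [← hq, proj_comp, proj_comp u, hu]
  -- The left factor is changed by exchange with a 2-cell `u ⇒ u'`; reassociating to `(u' f) v` then
  -- brings the right factor within reach of `cls_loop_hcomp_id_eq`.
  refine (cls_loop_hcomp_eq (link u u' hu) (hcomp f (id v)) hp hp₁ hq hq₁).trans ?_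
  have e : ∀ (r : S.Word y (ob w.tgt)) (h₁ : proj (u'.comp (p.comp r)) = w.arrow)
      (h₂ : proj (u'.comp (q.comp r)) = w.arrow)
      (h₃ : proj ((u'.comp p).comp r) = w.arrow) (h₄ : proj ((u'.comp q).comp r) = w.arrow),
      (loop (whisker u' f r) h₁ h₂).cls = (loop (hcomp (hcomp (id u') f) (id r)) h₃ h₄).cls := by
    intro r h₁ h₂ h₃ h₄
    induction f using Quotient.inductionOn with | _ f
    exact cls_loop_congr (Term.Rel.hcomp_assoc _ _ _).symm _ _ _ _
  refine (e v hp₁ hq₁ ?_ ?_).trans ((cls_loop_hcomp_id_eq _ hv _ _ ?_ ?_).trans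
    (e v' hp' hq' _ _).symm)
  · rw [Path.comp_assoc, hp₁]
  · rw [Path.comp_assoc, hq₁]
  · rw [Path.comp_assoc, hp']
  · rw [Path.comp_assoc, hq']

/-- Factoring `f ⋆₀ g` as `f p'` then `q g` puts `g` in the left context `u q`, whereas its bracket
carries the image of `u p`; the two images coincide. -/
theorem cls_loop_whisker_hcomp {x' : S.Obj} {p q : S.Word x' x} {p' q' : S.Word x y} (f : Cell p q)
    (g : Cell p' q') (u : S.Word (ob w.src) x') (v : S.Word y (ob w.tgt))
    (h : proj (u.comp ((p.comp p').comp v)) = w.arrow)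
    (h' : proj (u.comp ((q.comp q').comp v)) = w.arrow)
    (h₁ : proj (u.comp (p.comp (p'.comp v))) = w.arrow)
    (h₂ : proj (u.comp (q.comp (p'.comp v))) = w.arrow)
    (h₃ : proj ((u.comp q).comp (p'.comp v)) = w.arrow)
    (h₄ : proj ((u.comp q).comp (q'.comp v)) = w.arrow) :
    (loop (whisker u (hcomp f g) v) h h').cls =
      (loop (whisker u f (p'.comp v)) h₁ h₂).cls + (loop (whisker (u.comp q) g v) h₃ h₄).cls := by
  have h₅ : proj (u.comp ((q.comp p').comp v)) = w.arrow := by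
    rw [← h₂, Path.comp_assoc]
  rw [← hcomp_eq_left, whisker_vcomp, cls_loop_vcomp _ _ h h₅ h']
  induction f using Quotient.inductionOn with | _ f
  induction g using Quotient.inductionOn with | _ g
  congr 1
  · refine cls_loop_congr ?_ _ _ _ _
    refine Term.Rel.hcomp_congr (Term.Rel.refl _) ((Term.Rel.hcomp_assoc _ _ _).trans ?_)
    exact Term.Rel.hcomp_congr (Term.Rel.refl _) (Term.Rel.id_hcomp_id _ _)
  · refine cls_loop_congr ?_ _ _ _ _
    refine (Term.Rel.hcomp_congr (Term.Rel.refl _) (Term.Rel.hcomp_assoc _ _ _)).trans ?_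
    refine (Term.Rel.hcomp_assoc _ _ _).symm.trans ?_
    exact Term.Rel.hcomp_congr (Term.Rel.id_hcomp_id _ _) (Term.Rel.refl _)

end Cell

/-! ### The left inverse of `⟨f⟩ ↦ [f]` -/

/-- The 1-cell `p` in a context with representatives `u`, `v` has image `w`. -/
theorem proj_context {x y : S.Obj} {w : FactCat S.Pres} {p p' : S.Word x y} (k : bar p ⟶ w)
    {u : S.Word (ob w.src) x} {v : S.Word y (ob w.tgt)} (hu : proj u = FactCat.Hom.l k)
    (hv : proj v = FactCat.Hom.r k) (h : proj p' = proj p) :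
    proj (u.comp (p'.comp v)) = w.arrow := by
  rw [proj_comp, proj_comp, hu, hv, h]
  exact FactCat.Hom.fac k

/-- The morphism of groups that sends `l [α] r` to the class of the loop of `u α v`, where `u` and
`v` represent `l` and `r`. -/
noncomputable def loopHom (w : FactCat S.Pres) : S.fnat₂.obj w →+ IdGroup w :=
  FreeAbelianGroup.lift fun a : Σ i, (S.gens₂ i ⟶ w) =>
    (Cell.loop (Cell.whisker (rep (FactCat.Hom.l a.2)) (Cell.gen a.1.2.2.2.2)
      (rep (FactCat.Hom.r a.2)))
      (proj_context a.2 (proj_rep _) (proj_rep _) rfl)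
      (proj_context a.2 (proj_rep _) (proj_rep _) (proj_gen a.1.2.2.2.2).symm)).cls

/-- The representatives `u`, `v` are arbitrary because the horizontal case enlarges them to `p' v`
and `u q`, which need not be chosen representatives. -/
theorem loopHom_bracketIn {x y : S.Obj} {p q : S.Word x y} (f : Cell p q) {w : FactCat S.Pres}
    (k : bar p ⟶ w) (u : S.Word (ob w.src) x) (v : S.Word y (ob w.tgt))
    (hu : proj u = FactCat.Hom.l k) (hv : proj v = FactCat.Hom.r k)
    (hp : proj (u.comp (p.comp v)) = w.arrow) (hq : proj (u.comp (q.comp v)) = w.arrow) :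
    loopHom w (f.bracketIn k) = (Cell.loop (Cell.whisker u f v) hp hq).cls := by
  induction f using Quotient.inductionOn with | _ f
  induction f generalizing w with
  | gen a =>
    refine (congrArg (loopHom w) (Cell.bracketIn_gen a k)).trans
      ((FreeAbelianGroup.lift_apply_of _ _).trans ?_)
    -- Passing from the chosen representatives to `u`, `v` is where independence of the context is
    -- used.
    exact Cell.cls_loop_whisker_eq _ ((proj_rep _).trans hu.symm) ((proj_rep _).trans hv.symm)
      _ _ _ _
  | id p =>
    refine (congrArg _ (Cell.bracketIn_id p k)).trans ((map_zero _).trans ?_)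
    refine Eq.symm (Eq.trans ?_ (Cell.cls_loop_id _ hp))
    exact congrArg (fun f => (Cell.loop f hp hq).cls) (Cell.whisker_id u p v)
  | inv f ih =>
    refine (congrArg _ (Cell.bracketIn_inv (Quotient.mk _ f) k)).trans ((map_neg _ _).trans ?_)
    rw [ih (same f.proj_eq ≫ k) u v (by simp [hu]) (by simp [hv]) hq hp, ← Cell.cls_loop_inv]
    exact congrArg (fun f => (Cell.loop f hp hq).cls) (Cell.whisker_inv u (Quotient.mk _ f) v).symm
  | @vcomp _ _ p q r f g ihf ihg =>
    have h : proj (u.comp (q.comp v)) = w.arrow := proj_context k hu hv f.proj_eq.symm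
    refine (congrArg _ (Cell.bracketIn_vcomp (Quotient.mk _ f) (Quotient.mk _ g) k)).trans
      ((map_add _ _ _).trans ?_)
    rw [ihf k u v hu hv hp h, ihg (same f.proj_eq.symm ≫ k) u v (by simp [hu]) (by simp [hv]) h hq,
      ← Cell.cls_loop_vcomp]
    exact congrArg (fun f => (Cell.loop f hp hq).cls)
      (Cell.whisker_vcomp u (Quotient.mk _ f) (Quotient.mk _ g) v).symm
  | @hcomp _ _ _ p q p' q' f g ihf ihg =>
    have h₁ : proj (u.comp (p.comp (p'.comp v))) = w.arrow := by
      rw [← hp, Path.comp_assoc]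
    have h₂ : proj (u.comp (q.comp (p'.comp v))) = w.arrow := by
      rw [← h₁]; simp only [proj_comp, f.proj_eq]
    have h₃ : proj ((u.comp q).comp (p'.comp v)) = w.arrow := by
      rw [Path.comp_assoc, h₂]
    have h₄ : proj ((u.comp q).comp (q'.comp v)) = w.arrow := by
      rw [← hq, Path.comp_assoc, Path.comp_assoc]
    refine (congrArg _ (Cell.bracketIn_hcomp (Quotient.mk _ f) (Quotient.mk _ g) k)).trans
      ((map_add _ _ _).trans ?_)
    rw [ihf (right p p' ≫ k) u (p'.comp v) (by simp [hu]) (by simp [hv, proj_comp]) h₁ h₂,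
      ihg (left p p' ≫ k) (u.comp q) v (by simp [hu, f.proj_eq, proj_comp]) (by simp [hv]) h₃ h₄]
    exact (Cell.cls_loop_whisker_hcomp (Quotient.mk _ f) (Quotient.mk _ g) u v hp hq h₁ h₂ h₃
      h₄).symm

theorem loopHom_bracket (w : FactCat S.Pres) (a : IdGroup w) :
    loopHom w (IdGroup.bracket w a) = a := by
  suffices (loopHom w).comp (IdGroup.bracket w) = AddMonoidHom.id _ from DFunLike.congr_fun this a
  apply IdGroup.hom_ext
  rintro ⟨v, hv, f⟩
  refine (congrArg (loopHom w) (IdGroup.bracket_cls _)).trans ?_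
  have h : proj (Path.nil.comp (v.comp Path.nil)) = w.arrow := by
    rw [← hv, Path.nil_comp]; rfl
  -- The context has identity factors, which the empty words represent.
  refine (loopHom_bracketIn f _ Path.nil Path.nil (proj_nil _) (proj_nil _) h h).trans ?_
  refine Eq.trans ?_ (Cell.cls_loop_closed f hv)
  induction f using Quotient.inductionOn with | _ f
  exact Cell.cls_loop_congr ((Term.Rel.id_hcomp _).trans (Term.Rel.hcomp_id f)) _ _ _ _

/-! ### The contracting homotopy -/

/-- The bracket of the 2-cell `l̂ a ⇒ (l ā)^`, in the context `(1, r)`. -/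
noncomputable def stepBracket {w : FactCat S.Pres} {y z : S.Obj} (l : w.src ⟶ pt y) (a : y ⟶ z)
    (r : pt z ⟶ w.tgt) (h : l ≫ proj a.toPath ≫ r = w.arrow) : S.fnat₂.obj w :=
  (Cell.link ((rep l).comp a.toPath) (rep (l ≫ proj a.toPath))
    (by rw [proj_rep, proj_comp, proj_rep])).bracketIn (w := w)
      ⟨𝟙 w.src, r, (Category.id_comp _).trans (by
        refine (congrArg (· ≫ r) (proj_comp (rep l) a.toPath)).trans ?_
        rw [proj_rep, ← h]
        exact Category.assoc _ _ _)⟩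

/-- The morphism of groups that sends `l [a] r` to the bracket of `l̂ a ⇒ (l ā)^`, composed
with `r`. -/
noncomputable def stepHom (w : FactCat S.Pres) : S.fnat₁.obj w →+ S.fnat₂.obj w :=
  FreeAbelianGroup.lift fun a : Σ i, (S.gens₁ i ⟶ w) =>
    stepBracket (FactCat.Hom.l a.2) a.1.2.2 (FactCat.Hom.r a.2) (FactCat.Hom.fac a.2)

theorem stepHom_gen {w : FactCat S.Pres} {y z : S.Obj} (a : y ⟶ z) (k : bar a.toPath ⟶ w) :
    stepHom w (S.fnat₁.map k (freeNat.gen S.gens₁ ⟨_, _, a⟩)) =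
      stepBracket (FactCat.Hom.l k) a (FactCat.Hom.r k) (FactCat.Hom.fac k) := by
  have h : S.fnat₁.map k (freeNat.gen S.gens₁ ⟨_, _, a⟩) =
      FreeAbelianGroup.of (⟨⟨_, _, a⟩, k⟩ : Σ i, (S.gens₁ i ⟶ w)) := by
    refine (FreeAbelianGroup.map_of_apply _).trans ?_
    exact congrArg (fun k => FreeAbelianGroup.of (⟨⟨_, _, a⟩, k⟩ : Σ i, (S.gens₁ i ⟶ w)))
      (Category.id_comp k)
  rw [h]
  exact FreeAbelianGroup.lift_apply_of _ _

theorem bracketIn_normalise_comp_toPath {w : FactCat S.Pres} {y z : S.Obj}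
    (p : S.Word (ob w.src) y) (a : y ⟶ z) {v : w.src ⟶ pt z} (hv : proj (p.comp a.toPath) = v)
    (k : bar (p.comp a.toPath) ⟶ w) (k₁ : bar p ⟶ w) {l : w.src ⟶ pt y} {r : pt z ⟶ w.tgt}
    (hk : FactCat.Hom.l k = 𝟙 w.src) (hl₁ : FactCat.Hom.l k₁ = 𝟙 w.src)
    (hr₁ : FactCat.Hom.r k₁ = proj a.toPath ≫ FactCat.Hom.r k)
    (hl : proj p = l) (hr : FactCat.Hom.r k = r) (h : l ≫ proj a.toPath ≫ r = w.arrow) :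
    (Cell.normalise (p.comp a.toPath) v hv).bracketIn k =
      (Cell.normalise p l hl).bracketIn k₁ + stepBracket l a r h := by
  obtain rfl : l ≫ proj a.toPath = v := by
    rw [← hv, ← hl]; exact (proj_comp p a.toPath).symm
  subst hr
  rw [Cell.normalise_comp_toPath p a hl hv (by rw [proj_rep, proj_comp, proj_rep]),
    Cell.bracketIn_vcomp, Cell.bracketIn_hcomp, Cell.bracketIn_id, add_zero]
  refine congrArg₂ _ (Cell.bracketIn_congr _ ?_ ?_) (Cell.bracketIn_congr _ ?_ ?_)
  · exact (Category.comp_id (FactCat.Hom.l k)).trans (hk.trans hl₁.symm)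
  · exact hr₁.symm
  · exact (Category.comp_id (FactCat.Hom.l k)).trans hk
  · exact Category.id_comp (FactCat.Hom.r k)

/-- After `p` is normalised, each letter of `q` contributes one link, determined by the image of the
prefix before it. The bracket of `q` in the context of `p` lists exactly these letters with these
images, and `stepHom` turns each into its link. -/
theorem bracketIn_normalise_comp {w : FactCat S.Pres} {y z : S.Obj}
    (p : S.Word (ob w.src) y) (q : S.Word y z) {v : w.src ⟶ pt z} (hv : proj (p.comp q) = v)
    (k : bar (p.comp q) ⟶ w) (k₁ : bar p ⟶ w) (k₂ : bar q ⟶ w)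
    (hl : FactCat.Hom.l k = 𝟙 w.src) (hl₁ : FactCat.Hom.l k₁ = 𝟙 w.src)
    (hr₁ : FactCat.Hom.r k₁ = proj q ≫ FactCat.Hom.r k) (hl₂ : FactCat.Hom.l k₂ = proj p)
    (hr₂ : FactCat.Hom.r k₂ = FactCat.Hom.r k) :
    (Cell.normalise (p.comp q) v hv).bracketIn k =
      (Cell.normalise p (proj p) rfl).bracketIn k₁ + stepHom w (S.fnat₁.map k₂ (bracket₁ q)) := by
  induction q with
  | nil =>
    rw [bracket₁, map_zero, map_zero, add_zero]
    subst hv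
    refine Cell.bracketIn_congr _ (hl.trans hl₁.symm) ?_
    exact (hr₁.trans ((congrArg (· ≫ FactCat.Hom.r k) (proj_nil _)).trans
      (Category.id_comp _))).symm
  | @cons z t q a ih =>
    have h : proj (q.cons a) = proj q ≫ proj a.toPath := proj_comp q a.toPath
    refine (bracketIn_normalise_comp_toPath (p.comp q) a hv k (right (p.comp q) a.toPath ≫ k) hl
      ((Category.comp_id (FactCat.Hom.l k)).trans hl) rfl rfl rfl ?_).trans ?_
    · refine Eq.trans ?_ (FactCat.Hom.fac k)
      rw [hl, ← Category.assoc]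
      exact (congrArg (· ≫ FactCat.Hom.r k) (proj_comp (p.comp q) a.toPath).symm).trans
        (Category.id_comp _).symm
    · refine Eq.trans ?_ (congrArg (fun b => _ + stepHom w b)
        (map_bracket₁_comp_toPath q a k₂)).symm
      rw [map_add, ← add_assoc, ih rfl (right (p.comp q) a.toPath ≫ k) (right q a.toPath ≫ k₂)]
      · congr 1
        refine Eq.symm ((stepHom_gen a _).trans ?_)
        have e₁ : FactCat.Hom.l (left q a.toPath ≫ k₂) = proj (p.comp q) :=
          (congrArg (· ≫ proj q) hl₂).trans (proj_comp p q).symm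
        have e₂ : FactCat.Hom.r (left q a.toPath ≫ k₂) = FactCat.Hom.r k :=
          (Category.id_comp _).trans hr₂
        congr 1
      · exact (Category.comp_id (FactCat.Hom.l k)).trans hl
      · exact hr₁.trans ((congrArg (· ≫ FactCat.Hom.r k) h).trans (Category.assoc _ _ _))
      · exact (Category.comp_id (FactCat.Hom.l k₂)).trans hl₂
      · exact congrArg (proj a.toPath ≫ ·) hr₂

/-! ### Brackets of loops and the homotopy formula. -/

theorem bracketIn_toArrow_vcomp {w : FactCat S.Pres} {p q r : S.Word (ob w.src) (ob w.tgt)}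
    (f : Cell p q) (g : Cell q r) (hp : proj p = w.arrow) (hq : proj q = w.arrow) :
    (f.vcomp g).bracketIn (toArrow p hp) =
      f.bracketIn (toArrow p hp) + g.bracketIn (toArrow q hq) :=
  (Cell.bracketIn_vcomp f g _).trans (congrArg _ (Cell.bracketIn_congr g
    (Category.id_comp (𝟙 w.src)) (Category.id_comp (𝟙 w.tgt))))

theorem bracketIn_toArrow_inv {w : FactCat S.Pres} {p q : S.Word (ob w.src) (ob w.tgt)}
    (f : Cell p q) (hp : proj p = w.arrow) (hq : proj q = w.arrow) :
    f.inv.bracketIn (toArrow q hq) = - f.bracketIn (toArrow p hp) :=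
  (Cell.bracketIn_inv f _).trans (congrArg _ (Cell.bracketIn_congr f
    (Category.id_comp (𝟙 w.src)) (Category.id_comp (𝟙 w.tgt))))

theorem bracketIn_toArrow_conj {w : FactCat S.Pres} {p q r : S.Word (ob w.src) (ob w.tgt)}
    (f : Cell p q) (g : Cell p r) (g' : Cell q r) (hp : proj p = w.arrow) (hq : proj q = w.arrow)
    (hr : proj r = w.arrow) : (g.inv.vcomp (f.vcomp g')).bracketIn (toArrow r hr) =
      f.bracketIn (toArrow p hp) -
        (g.bracketIn (toArrow p hp) - g'.bracketIn (toArrow q hq)) := by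
  rw [bracketIn_toArrow_vcomp _ _ hr hp, bracketIn_toArrow_vcomp _ _ hp hq,
    bracketIn_toArrow_inv _ hp]
  abel

theorem bracket_cls_loop {w : FactCat S.Pres} {p q : S.Word (ob w.src) (ob w.tgt)} (f : Cell p q)
    (hp : proj p = w.arrow) (hq : proj q = w.arrow) :
    IdGroup.bracket w (f.loop hp hq).cls = f.bracketIn (toArrow p hp) -
      ((Cell.normalise p w.arrow hp).bracketIn (toArrow p hp) -
        (Cell.normalise q w.arrow hq).bracketIn (toArrow q hq)) := by
  refine (IdGroup.bracket_cls _).trans ?_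
  exact bracketIn_toArrow_conj f _ _ hp hq (proj_rep _)

/-- Only the middle term involves `p` beyond its image. The contexts `k₁`, `k₂` are parameters so
that the source and the target of a generating 2-cell can share them, making the outer terms cancel.
-/
theorem bracketIn_normalise_context {x y : S.Obj} {w : FactCat S.Pres} {p : S.Word x y}
    (k : bar p ⟶ w) {u : S.Word (ob w.src) x} {v : S.Word y (ob w.tgt)}
    (hu : proj u = FactCat.Hom.l k) (hv : proj v = FactCat.Hom.r k)
    (hp : proj (u.comp (p.comp v)) = w.arrow) (k₁ : bar u ⟶ w) (k₂ : bar v ⟶ w)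
    (hl₁ : FactCat.Hom.l k₁ = 𝟙 w.src) (hr₁ : FactCat.Hom.r k₁ = proj p ≫ FactCat.Hom.r k)
    (hl₂ : FactCat.Hom.l k₂ = FactCat.Hom.l k ≫ proj p) (hr₂ : FactCat.Hom.r k₂ = 𝟙 w.tgt) :
    (Cell.normalise (u.comp (p.comp v)) w.arrow hp).bracketIn (toArrow _ hp) =
      (Cell.normalise u (proj u) rfl).bracketIn k₁ + stepHom w (S.fnat₁.map k (bracket₁ p)) +
        stepHom w (S.fnat₁.map k₂ (bracket₁ v)) := by
  have e := (proj_comp u (p.comp v)).symm.trans hp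
  refine (bracketIn_normalise_comp u (p.comp v) hp (toArrow _ hp) k₁
    ⟨proj u, 𝟙 w.tgt, (congrArg (proj u ≫ ·) (Category.comp_id _)).trans e⟩ rfl hl₁ ?_ rfl
    rfl).trans ?_
  · refine hr₁.trans (Eq.symm ((Category.comp_id (proj (p.comp v))).trans ?_))
    rw [proj_comp, hv]
  · rw [add_assoc, ← map_add]
    refine congrArg (fun b => _ + stepHom w b) (map_bracket₁_comp p v _ k k₂ hu.symm ?_ ?_ hr₂)
    · exact hv.symm.trans (Category.comp_id (proj v)).symm
    · exact hl₂.trans (congrArg (· ≫ proj p) hu.symm)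

/-- On `l [α] r`, with `α : p ⇒ q`, the loop of `u α v` adds to the bracket of `α` the difference of
the normalisations of `u q v` and `u p v`, which is `stepHom` of `l [q] r - l [p] r`. -/
theorem bracket_loopHom (w : FactCat S.Pres) (a : S.fnat₂.obj w) :
    IdGroup.bracket w (loopHom w a) = a - stepHom w (S.δ₂.app w a) := by
  suffices (IdGroup.bracket w).comp (loopHom w) =
      AddMonoidHom.id _ - (stepHom w).comp (S.δ₂.app w).hom from DFunLike.congr_fun this a
  apply FreeAbelianGroup.lift_ext
  rintro ⟨⟨x, y, p, q, a⟩, k⟩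
  change bar p ⟶ w at k
  have hu := proj_rep (FactCat.Hom.l k)
  have hv := proj_rep (FactCat.Hom.r k)
  have hp := proj_context k hu hv rfl
  have hq := proj_context k hu hv (proj_gen a).symm
  have e : loopHom w ((Cell.gen a).bracketIn k) = _ :=
    loopHom_bracketIn (Cell.gen a) k _ _ hu hv hp hq
  have h₁ : 𝟙 w.src ≫ proj (rep (FactCat.Hom.l k)) ≫ (proj p ≫ FactCat.Hom.r k) = w.arrow := by
    rw [hu]; exact (Category.id_comp _).trans (FactCat.Hom.fac k)
  have h₂ : (FactCat.Hom.l k ≫ proj p) ≫ proj (rep (FactCat.Hom.r k)) ≫ 𝟙 w.tgt = w.arrow := by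
    rw [hv, Category.comp_id, Category.assoc]; exact FactCat.Hom.fac k
  have e₁ := bracketIn_normalise_context k hu hv hp ⟨_, _, h₁⟩ ⟨_, _, h₂⟩ rfl rfl rfl rfl
  have e₂ := bracketIn_normalise_context (same (proj_gen a).symm ≫ k) (hu.trans (by simp))
    (hv.trans (by simp)) hq ⟨_, _, h₁⟩ ⟨_, _, h₂⟩ rfl (by simp [proj_gen a])
    (by simp [proj_gen a]) rfl
  refine (congrArg (fun b => IdGroup.bracket w (loopHom w b)) (Cell.bracketIn_gen a k).symm).trans ?_
  refine Eq.trans ?_ (congrArg (fun b => b - stepHom w (S.δ₂.app w b)) (Cell.bracketIn_gen a k))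
  -- The contributions of `v`, then those of `u`, cancel between source and target.
  rw [e, δ₂_gen, bracket_cls_loop, e₁, e₂, map_sub, add_sub_add_right_eq_sub,
    add_sub_add_left_eq_sub]
  congr 1
  refine (Cell.bracketIn_whisker _ _ _ _).trans (Cell.bracketIn_congr _ ?_ ?_)
  · refine (congrArg (fun b => (𝟙 w.src ≫ b) ≫ 𝟙 _) hu).trans ?_
    simp
  · refine (congrArg (fun b => b ≫ 𝟙 w.tgt ≫ 𝟙 w.tgt) hv).trans ?_
    simp

end TwoPolygraph

open TwoPolygraph in
/-- The natural system of homological 2-syzygies is the kernel of `δ₂`, in the abelian category of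
natural systems on the presented category. -/
theorem mainTheorem4 (S : TwoPolygraph.{u}) :
    ∃ e : S.identities ≅ Limits.kernel S.δ₂,
      ∀ {x y : S.Obj} {v : S.Word x y} (f : TwoPolygraph.Cell v v),
        (Limits.kernel.ι S.δ₂).app (TwoPolygraph.bar v)
          (e.hom.app (TwoPolygraph.bar v) f.cls) = f.bracket := by
  let φ : S.identities ⟶ Limits.kernel S.δ₂ := Limits.kernel.lift S.δ₂ S.bracketHom bracketHom_δ₂
  have hφ : φ ≫ Limits.kernel.ι S.δ₂ = S.bracketHom := Limits.kernel.lift_ι _ _ _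
  have hφ' : ∀ (w : FactCat S.Pres) (a : S.identities.obj w),
      (Limits.kernel.ι S.δ₂).app w (φ.app w a) = IdGroup.bracket w a := fun w a =>
    congrArg (fun g : S.identities ⟶ S.fnat₂ => g.app w a) hφ
  -- A monomorphism of natural systems is a monomorphism at each object, so equalities in the kernel
  -- can be tested in the free natural system.
  have hι : ∀ w : FactCat S.Pres, Function.Injective ((Limits.kernel.ι S.δ₂).app w) := fun w =>
    (AddCommGrpCat.mono_iff_injective _).1 inferInstance
  have : ∀ w, IsIso (φ.app w) := by
    intro w
    rw [ConcreteCategory.isIso_iff_bijective]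
    constructor
    · intro a b hab
      have h := congrArg ((Limits.kernel.ι S.δ₂).app w) hab
      rw [hφ', hφ'] at h
      exact (loopHom_bracket w a).symm.trans ((congrArg _ h).trans (loopHom_bracket w b))
    · intro b
      -- The preimage comes from the homotopy formula, whose correction term is killed because `b`
      -- lies in the kernel.
      refine ⟨loopHom w ((Limits.kernel.ι S.δ₂).app w b), hι w ?_⟩
      refine (hφ' w _).trans ((bracket_loopHom w _).trans ?_)
      have h : S.δ₂.app w ((Limits.kernel.ι S.δ₂).app w b) = 0 :=
        congrArg (fun g : Limits.kernel S.δ₂ ⟶ S.fnat₁ => g.app w b)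
          (Limits.kernel.condition S.δ₂)
      rw [h, map_zero, sub_zero]
  have : IsIso φ := NatIso.isIso_of_isIso_app φ
  refine ⟨asIso φ, fun f => ?_⟩
  exact (hφ' _ _).trans (bracketHom_cls f)
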